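/- **Conventions.** $\mathsf{Dia}$ is a class of small categories that contains the finite posets and is closed under binary products, binary coproducts and the comma categories $u/b$, $b/u$ (for functors $u:A\to B$ in $\mathsf{Dia}$ and $b\in B$); it is regarded as a full sub-2-category of $\mathrm{Cat}$. A prederivator is a 2-functor $\mathbb D:\mathsf{Dia}^{\mathrm{op}}\to\mathrm{CAT}$ (contravariant on functors, covariant on natural transformations), 1-cells of prederivators are pseudonatural transformations and 2-cells are modifications. A derivator is a prederivator satisfying: (Der1) $\mathbb D$ sends finite coproducts to products, up to equivalence; (Der2) isomorphisms in $\mathbb D(J)$ are detected at the objects of $J$; (Der3) every $u^*$ has a left adjoint $u_!$ and a right adjoint $u_*$; (Der4) $u_!$ and $u_*$ are computed pointwise by the comma categories $u/b$ and $b/u$. Put $\mathbb D^{[n]}(J)=\mathbb D(J\times[n])$, where $[n]=\{0<\dots<n\}$. A sub-prederivator is a family of classes of objects (full subcategories) stable under all $u^*$. **Reflections.** A reflection of $\mathbb D$ is an adjunction $L\dashv R:\mathbb D\rightleftarrows\mathbb E$ of prederivators with every $R_J$ fully faithful. Let $\mathbb{Chr}_L\subseteq\mathbb D^{[1]}$ consist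 of the $X\in\mathbb D^{[1]}(J)$ such that $X_1$ lies in the essential image of $R_J$, and let $R^\sharp:\mathbb{Chr}_L\to\mathbb D$ be the restriction of evaluation at $0$. The reflection is choric if $R^\sharp$ has a left adjoint in the 2-category of prederivators. Choric reflections are preordered by levelwise inclusion of the essential images of the right adjoints; the poset of choric reflections is obtained by identifying reflections with the same essential images. **Prefactorization systems.** For $X,Y\in\mathbb D^{[1]}(J)$ and the projection $p:J\times[1]\to J$, write $X\perp Y$ if precomposition with the unit $X\to p^*p_!X$ is a bijection $\mathrm{Hom}(p^*p_!X,Y)\to\mathrm{Hom}(X,Y)$ in $\mathbb D(J\times[1])$. A derivator prefactorization system on $\mathbb D$ is a pair $\mathfrak F=(\mathcal E,\mathcal M)$ of sub-prederivators of $\mathbb D^{[1]}$ such that for every $J$, $\mathcal E(J)={}^{\perp}\mathcal M(J)$ and $\mathcal M(J)=\mathcal E(J)^{\perp}$. These are ordered by inclusion of the classes $\mathcal M$. Let $\mathbb D_{\mathfrak F}(J)\subseteq\mathbb D(J\times[2])$ be the full subcategory of those $X$ with $X_{(0,1)}\in\mathcal E(J)$ and $X_{(1,2)}\in\mathcal M(J)$,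 and let $\Psi_{\mathfrak F}:\mathbb D_{\mathfrak F}\to\mathbb D^{[1]}$, $X\mapsto X_{(0,2)}$. The terminal arrow of $X\in\mathbb D(J)$ is $0_*X=[X\to *]\in\mathbb D^{[1]}(J)$, where $0_*$ is right Kan extension along $J\times\{0\}\hookrightarrow J\times[1]$. The system $\mathfrak F$ is $\tau$-choric if for every $J$ the restriction of $\Psi_{\mathfrak F,J}$ to those objects which it sends into the essential image of $0_*$ is fully faithful. It is reflective if $\mathcal E$ is a 3-for-2 class (for every $X\in\mathbb D(J\times[2])$, if two of $X_{(0,1)},X_{(1,2)},X_{(0,2)}$ lie in $\mathcal E(J)$, so does the third) and every terminal arrow has an $(\mathcal E,\mathcal M)$-factorization (for every $X\in\mathbb D(J)$ there is $Z\in\mathbb D_{\mathfrak F}(J)$ with $\Psi_{\mathfrak F}Z\cong 0_*X$). **Proposition.** Let $\mathbb D$ be a derivator. There is an isomorphism of posets between the poset of choric reflections of $\mathbb D$ and the poset of reflective, $\tau$-choric derivator prefactorization systems on $\mathbb D$. It can be chosen such that, if $L\dashv R$ corresponds to $(\mathcal E,\mathcal M)$, then for every $J$: an object $X\in\mathbb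 D^{[1]}(J)$ lies in $\mathcal E(J)$ if and only if the arrow $(LX)_0\to(LX)_1$ underlying $LX\in\mathbb E(J\times[1])$ is invertible, and an object $Y\in\mathbb D(J)$ lies in the essential image of $R_J$ if and only if its terminal arrow $0_*Y$ lies in $\mathcal M(J)$. -/

import Mathlib

open CategoryTheory Bicategory Opposite
open scoped CategoryTheory.Pseudofunctor.StrongTrans

universe w v u

/-! ### Categories of diagrams -/

/-- The linearly ordered set with `n` elements, in an arbitrary universe. -/
def Chain (n : ℕ) : Type w := ULift.{w} (Fin n)

instance (n : ℕ) : PartialOrder (Chain.{w} n) := inferInstanceAs (PartialOrder (ULift.{w} (Fin n)))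

instance (n : ℕ) : Finite (Chain.{w} n) := inferInstanceAs (Finite (ULift.{w} (Fin n)))

/-- A category of diagrams `Dia`: a class of small categories which contains the finite posets and
is closed under binary products, binary coproducts, and the comma categories `u/b`, `b/u`. -/
structure DiagramCategory where
  mem : ∀ (J : Type w) [SmallCategory J], Prop
  mem_poset : ∀ (P : Type w) [PartialOrder P] [Finite P], mem P
  mem_prod : ∀ (J K : Type w) [SmallCategory J] [SmallCategory K], mem J → mem K → mem (J × K)
  mem_sum : ∀ (J K : Type w) [SmallCategory J] [SmallCategory K], mem J → mem K → mem (J ⊕ K)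
  mem_costructuredArrow : ∀ {J K : Type w} [SmallCategory J] [SmallCategory K] (u : J ⥤ K) (k : K),
    mem J → mem K → mem (CostructuredArrow u k)
  mem_structuredArrow : ∀ {J K : Type w} [SmallCategory J] [SmallCategory K] (u : J ⥤ K) (k : K),
    mem J → mem K → mem (StructuredArrow k u)

/-- The objects of `Dia`. -/
structure DiagramCategory.Obj (𝒦 : DiagramCategory.{w}) : Type (w + 1) where
  carrier : Type w
  [cat : SmallCategory carrier]
  mem : 𝒦.mem carrier

namespace DiagramCategory

variable {𝒦 : DiagramCategory.{w}}

instance : CoeSort 𝒦.Obj (Type w) := ⟨Obj.carrier⟩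

instance (J : 𝒦.Obj) : SmallCategory J := J.cat

/-- `Dia` as a full sub-2-category of the 2-category of small categories: 1-cells are functors,
2-cells are natural transformations. -/
instance : Bicategory.{w, w} 𝒦.Obj where
  Hom J K := J ⥤ K
  id J := 𝟭 J
  comp u v := u ⋙ v
  whiskerLeft u _ _ α := Functor.whiskerLeft u α
  whiskerRight α v := Functor.whiskerRight α v
  associator u v w := Functor.associator u v w
  leftUnitor u := Functor.leftUnitor u
  rightUnitor u := Functor.rightUnitor u

end DiagramCategory

namespace DiagramCategory

variable (𝒦 : DiagramCategory.{w})

/-- The ordinal `[n] = {0 < 1 < ⋯ < n}`. -/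
def ord (n : ℕ) : 𝒦.Obj := ⟨Chain.{w} (n + 1), 𝒦.mem_poset _⟩

/-- The element `i` of `[n]`. -/
def vertex {n : ℕ} (i : Fin (n + 1)) : 𝒦.ord n := (ULift.up i : ULift.{w} (Fin (n + 1)))

/-- The arrow `i ⟶ j` of `[n]`. -/
def edge {n : ℕ} {i j : Fin (n + 1)} (h : i ≤ j) : 𝒦.vertex i ⟶ 𝒦.vertex j :=
  homOfLE (X := Chain.{w} (n + 1)) (x := ULift.up i) (y := ULift.up j) h

/-- The terminal category `e`. -/
def pt : 𝒦.Obj := 𝒦.ord 0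

/-- The empty category. -/
def empty : 𝒦.Obj := ⟨Chain.{w} 0, 𝒦.mem_poset _⟩

variable {𝒦}

/-- The 1-cell of `Diaᵒᵖ` given by a functor. -/
abbrev op₁ {J K : 𝒦.Obj} (u : J ⥤ K) : op K ⟶ op J := Quiver.Hom.op (V := 𝒦.Obj) (X := J) (Y := K) u

/-- The 2-cell of `Diaᵒᵖ` given by a natural transformation. -/
abbrev op₂ {J K : 𝒦.Obj} {u v : J ⥤ K} (α : u ⟶ v) : op₁ u ⟶ op₁ v :=
  Bicategory.Opposite.op2 (B := 𝒦.Obj) (a := J) (b := K) (f := u) (g := v) α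

/-- The product `J × K`. -/
def Obj.prod (J K : 𝒦.Obj) : 𝒦.Obj := ⟨J × K, 𝒦.mem_prod _ _ J.mem K.mem⟩

/-- The coproduct `J ⊔ K`. -/
def Obj.sum (J K : 𝒦.Obj) : 𝒦.Obj := ⟨J ⊕ K, 𝒦.mem_sum _ _ J.mem K.mem⟩

def inl (J K : 𝒦.Obj) : J ⥤ J.sum K := Sum.inl_ J K

def inr (J K : 𝒦.Obj) : K ⥤ J.sum K := Sum.inr_ J K

/-- The unique functor to the terminal category. -/
def toPt (J : 𝒦.Obj) : J ⥤ 𝒦.pt := (Functor.const J).obj (𝒦.vertex 0)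

/-- The functor `e ⥤ J` picking out `j`. -/
def point {J : 𝒦.Obj} (j : J) : 𝒦.pt ⥤ J := (Functor.const 𝒦.pt).obj j

/-- The comma category `u/b`. -/
def sliceOver {A B : 𝒦.Obj} (u : A ⥤ B) (b : B) : 𝒦.Obj :=
  ⟨CostructuredArrow u b, 𝒦.mem_costructuredArrow u b A.mem B.mem⟩

/-- The comma category `b/u`. -/
def sliceUnder {A B : 𝒦.Obj} (u : A ⥤ B) (b : B) : 𝒦.Obj :=
  ⟨StructuredArrow b u, 𝒦.mem_structuredArrow u b A.mem B.mem⟩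

def sliceOverProj {A B : 𝒦.Obj} (u : A ⥤ B) (b : B) : sliceOver u b ⥤ A :=
  CostructuredArrow.proj u b

def sliceUnderProj {A B : 𝒦.Obj} (u : A ⥤ B) (b : B) : sliceUnder u b ⥤ A :=
  StructuredArrow.proj b u

/-- The canonical 2-cell of the comma square of `u/b`. -/
def sliceOverCell {A B : 𝒦.Obj} (u : A ⥤ B) (b : B) :
    sliceOverProj u b ⋙ u ⟶ toPt (sliceOver u b) ⋙ point b where
  app f := CostructuredArrow.hom f
  naturality _ _ g := (CostructuredArrow.w g).trans (Category.comp_id _).symm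

/-- The canonical 2-cell of the comma square of `b/u`. -/
def sliceUnderCell {A B : 𝒦.Obj} (u : A ⥤ B) (b : B) :
    toPt (sliceUnder u b) ⋙ point b ⟶ sliceUnderProj u b ⋙ u where
  app f := StructuredArrow.hom f
  naturality _ _ g := (Category.id_comp _).trans (StructuredArrow.w g).symm

/-- The functor `u × K : J × K ⥤ J' × K`. -/
def prodMap {J J' : 𝒦.Obj} (u : J ⥤ J') (K : 𝒦.Obj) : J.prod K ⥤ J'.prod K :=
  u.prod (𝟭 K)

/-- The natural transformation `α × K : u × K ⟶ v × K`. -/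
def prodMap₂ {J J' : 𝒦.Obj} {u v : J ⥤ J'} (α : u ⟶ v) (K : 𝒦.Obj) :
    prodMap u K ⟶ prodMap v K :=
  NatTrans.prod α (𝟙 (𝟭 K))

lemma prodMap₂_comp {J J' : 𝒦.Obj} {u v t : J ⥤ J'} (α : u ⟶ v) (β : v ⟶ t) (K : 𝒦.Obj) :
    prodMap₂ (α ≫ β) K = prodMap₂ α K ≫ prodMap₂ β K := by
  ext x
  exact Prod.ext rfl (Category.comp_id _).symm

lemma prodMap₂_whiskerLeft {I J J' : 𝒦.Obj} (t : I ⥤ J) {u v : J ⥤ J'} (α : u ⟶ v)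
    (K : 𝒦.Obj) :
    prodMap₂ (Functor.whiskerLeft t α) K = Functor.whiskerLeft (prodMap t K) (prodMap₂ α K) :=
  rfl

lemma prodMap₂_whiskerRight {J J' I : 𝒦.Obj} {u v : J ⥤ J'} (α : u ⟶ v) (t : J' ⥤ I)
    (K : 𝒦.Obj) :
    prodMap₂ (Functor.whiskerRight α t) K = Functor.whiskerRight (prodMap₂ α K) (prodMap t K) :=
  rfl

/-- The functor `J × w : J × K ⥤ J × K'`. -/
def prodMapRight (J : 𝒦.Obj) {K K' : 𝒦.Obj} (w : K ⥤ K') : J.prod K ⥤ J.prod K' :=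
  (𝟭 J).prod w

/-- The projection `J × K ⥤ J`. -/
def fst (J K : 𝒦.Obj) : J.prod K ⥤ J := CategoryTheory.Prod.fst J K

/-- The functor `(id, k) : J ⥤ J × K`. -/
def slot (J : 𝒦.Obj) {K : 𝒦.Obj} (k : K) : J ⥤ J.prod K := Prod.sectL J k

/-- The natural transformation `(id, k) ⟶ (id, l)` given by an arrow `k ⟶ l` of `K`. -/
def slotMap (J : 𝒦.Obj) {K : 𝒦.Obj} {k l : K} (f : k ⟶ l) : slot J k ⟶ slot J l where
  app x := (𝟙 x, f)
  naturality _ _ g := Prod.ext ((Category.comp_id g).trans (Category.id_comp g).symm)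
    ((Category.id_comp f).trans (Category.comp_id f).symm)

/-- The functor `[1] ⥤ [n]` with image the arrow `i ⟶ j`. -/
def face (𝒦 : DiagramCategory.{w}) {n : ℕ} {i j : Fin (n + 1)} (h : i ≤ j) :
    𝒦.ord 1 ⥤ 𝒦.ord n :=
  Monotone.functor (X := Chain.{w} 2) (Y := Chain.{w} (n + 1))
    (f := fun x => ULift.up (if ULift.down x = 0 then i else j)) (by
      intro x y hxy
      change (if ULift.down x = 0 then i else j) ≤ (if ULift.down y = 0 then i else j)
      have hxy' : ULift.down x ≤ ULift.down y := hxy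
      split_ifs with hx hy hy
      · exact le_rfl
      · exact h
      · exact absurd (Fin.le_zero_iff.mp (hy ▸ hxy')) hx
      · exact le_rfl)

end DiagramCategory

/-! ### Prederivators and derivators -/

set_option linter.checkUnivs false in
/-- Prederivators: 2-functors `D : Diaᵒᵖ ⥤ CAT`, contravariant on 1-cells and covariant on 2-cells.
The 1-cells between prederivators are the pseudonatural transformations and the 2-cells are
the modifications. -/
abbrev Prederivator (𝒦 : DiagramCategory.{w}) := Pseudofunctor 𝒦.Objᵒᵖ Cat.{v, u}

namespace Prederivator

open DiagramCategory

variable {𝒦 : DiagramCategory.{w}} (D : Prederivator.{w, v, u} 𝒦)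

/-- The category `D(J)`. -/
abbrev on (J : 𝒦.Obj) : Cat.{v, u} := D.obj (op J)

/-- The functor `u^* : D(K) ⥤ D(J)` induced by `u : J ⥤ K`. -/
abbrev pull {J K : 𝒦.Obj} (u : J ⥤ K) : D.on K ⥤ D.on J := (D.map (op₁ u)).toFunctor

/-- The natural transformation `α^* : u^* ⟶ v^*` induced by `α : u ⟶ v`. -/
abbrev pull₂ {J K : 𝒦.Obj} {u v : J ⥤ K} (α : u ⟶ v) : D.pull u ⟶ D.pull v :=
  (D.map₂ (op₂ α)).toNatTrans

/-- The isomorphism `(u ⋙ v)^* ≅ v^* ⋙ u^*`. -/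
abbrev pullComp {J K M : 𝒦.Obj} (u : J ⥤ K) (v : K ⥤ M) :
    D.pull (u ⋙ v) ≅ D.pull v ⋙ D.pull u :=
  Cat.Hom.toNatIso (D.mapComp (op₁ v) (op₁ u))

/-- The 2-cell `p^* ⋙ u^* ⟶ q^* ⋙ v^*` induced by a 2-cell `α : u ⋙ p ⟶ v ⋙ q`. -/
def square {A B B' C : 𝒦.Obj} {u : A ⥤ B} {p : B ⥤ C} {v : A ⥤ B'} {q : B' ⥤ C}
    (α : u ⋙ p ⟶ v ⋙ q) : D.pull p ⋙ D.pull u ⟶ D.pull q ⋙ D.pull v :=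
  (D.pullComp u p).inv ≫ D.pull₂ α ≫ (D.pullComp v q).hom

/-- A derivator is a prederivator which satisfies the axioms (Der1)-(Der4). -/
class IsDerivator : Prop where
  /-- (Der1) for the empty coproduct: `D(∅)` is equivalent to the terminal category. -/
  der1_empty : ((Functor.const (D.on 𝒦.empty)).obj (Discrete.mk PUnit.unit) :
    D.on 𝒦.empty ⥤ Discrete PUnit.{1}).IsEquivalence
  /-- (Der1) for binary coproducts: `D(J ⊔ K) ⥤ D(J) × D(K)` is an equivalence. -/
  der1_sum : ∀ J K : 𝒦.Obj,
    ((D.pull (inl J K)).prod' (D.pull (inr J K))).IsEquivalence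
  /-- (Der2): isomorphisms are detected pointwise. -/
  der2 : ∀ (J : 𝒦.Obj) {X Y : D.on J} (f : X ⟶ Y),
    (∀ j : J, IsIso ((D.pull (point j)).map f)) → IsIso f
  /-- (Der3): existence of the left Kan extension functors `u_!`. -/
  der3_lan : ∀ {A B : 𝒦.Obj} (u : A ⥤ B), (D.pull u).IsRightAdjoint
  /-- (Der3): existence of the right Kan extension functors `u_*`. -/
  der3_ran : ∀ {A B : 𝒦.Obj} (u : A ⥤ B), (D.pull u).IsLeftAdjoint
  /-- (Der4) for left Kan extensions: the mate `π_! q^* ⟶ b^* u_!` is invertible, where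
  `q : u/b ⥤ A` and `π : u/b ⥤ e` are the projections. -/
  der4_lan : ∀ {A B : 𝒦.Obj} (u : A ⥤ B) (b : B)
    {lan : D.on A ⥤ D.on B} {colim : D.on (sliceOver u b) ⥤ D.on 𝒦.pt}
    (adj : lan ⊣ D.pull u) (adj' : colim ⊣ D.pull (toPt (sliceOver u b))),
    IsIso ((mateEquiv adj adj').symm (.mk _ _ _ _ (D.square (sliceOverCell u b)))).natTrans
  /-- (Der4) for right Kan extensions: the mate `b^* u_* ⟶ π_* p^*` is invertible, where
  `p : b/u ⥤ A` and `π : b/u ⥤ e` are the projections. -/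
  der4_ran : ∀ {A B : 𝒦.Obj} (u : A ⥤ B) (b : B)
    {ran : D.on A ⥤ D.on B} {lim : D.on (sliceUnder u b) ⥤ D.on 𝒦.pt}
    (adj : D.pull u ⊣ ran) (adj' : D.pull (toPt (sliceUnder u b)) ⊣ lim),
    IsIso (mateEquiv adj adj' (.mk _ _ _ _ (D.square (sliceUnderCell u b)))).natTrans

attribute [instance] IsDerivator.der3_lan IsDerivator.der3_ran

section KanExtensions

variable [IsDerivator D]

/-- The left Kan extension functor `u_!`. -/
noncomputable def lan {A B : 𝒦.Obj} (u : A ⥤ B) : D.on A ⥤ D.on B := (D.pull u).leftAdjoint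

noncomputable def lanAdj {A B : 𝒦.Obj} (u : A ⥤ B) : D.lan u ⊣ D.pull u :=
  CategoryTheory.Adjunction.ofIsRightAdjoint (D.pull u)

/-- The right Kan extension functor `u_*`. -/
noncomputable def ran {A B : 𝒦.Obj} (u : A ⥤ B) : D.on A ⥤ D.on B := (D.pull u).rightAdjoint

noncomputable def ranAdj {A B : 𝒦.Obj} (u : A ⥤ B) : D.pull u ⊣ D.ran u :=
  CategoryTheory.Adjunction.ofIsLeftAdjoint (D.pull u)

end KanExtensions

/-- The shifted prederivator `D^K`, with `D^K(J) = D(J × K)`. -/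
def shift (K : 𝒦.Obj) : Prederivator.{w, v, u} 𝒦 where
  obj J := D.on (J.unop.prod K)
  map u := D.map (op₁ (prodMap u.unop K))
  map₂ α := D.map₂ (op₂ (prodMap₂ α.unop2 K))
  map₂_id u := D.map₂_id (op₁ (prodMap u.unop K))
  map₂_comp α β := (congrArg (fun γ => D.map₂ (op₂ γ)) (prodMap₂_comp α.unop2 β.unop2 K)).trans
    (D.map₂_comp (op₂ (prodMap₂ α.unop2 K)) (op₂ (prodMap₂ β.unop2 K)))
  mapId J := D.mapId (op (J.unop.prod K))
  mapComp u v := D.mapComp (op₁ (prodMap u.unop K)) (op₁ (prodMap v.unop K))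
  map₂_whisker_left u _ _ α :=
    (congrArg (fun γ => D.map₂ (op₂ γ)) (prodMap₂_whiskerRight α.unop2 u.unop K)).trans
      (D.map₂_whisker_left (op₁ (prodMap u.unop K)) (op₂ (prodMap₂ α.unop2 K)))
  map₂_whisker_right α v :=
    (congrArg (fun γ => D.map₂ (op₂ γ)) (prodMap₂_whiskerLeft v.unop α.unop2 K)).trans
      (D.map₂_whisker_right (op₂ (prodMap₂ α.unop2 K)) (op₁ (prodMap v.unop K)))
  map₂_associator u v w := D.map₂_associator (op₁ (prodMap u.unop K)) (op₁ (prodMap v.unop K))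
    (op₁ (prodMap w.unop K))
  map₂_left_unitor u := D.map₂_left_unitor (op₁ (prodMap u.unop K))
  map₂_right_unitor u := D.map₂_right_unitor (op₁ (prodMap u.unop K))

lemma mapComp_assoc {a b c d : 𝒦.Objᵒᵖ} (f : a ⟶ b) (g : b ⟶ c) (h : c ⟶ d) :
    (D.mapComp f (g ≫ h)).hom ≫ D.map f ◁ (D.mapComp g h).hom =
      (D.mapComp (f ≫ g) h).hom ≫ (D.mapComp f g).hom ▷ D.map h ≫
        (α_ (D.map f) (D.map g) (D.map h)).hom := by
  have e : D.map₂ (α_ f g h).inv = 𝟙 (D.map ((f ≫ g) ≫ h)) := D.map₂_id _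
  refine (Pseudofunctor.mapComp_assoc_right_hom D f g h).trans ?_
  rw [e]
  exact Category.id_comp _

lemma eval_aux {C : Type*} [Bicategory C] {a b c a' b' c' : C} {f : a ⟶ b} {g : b ⟶ c}
    {t : c ⟶ c'} {s : b ⟶ b'} {r : a ⟶ a'} {x : a' ⟶ b'} {y : b' ⟶ c'} {p : a ⟶ c'} {fg : a ⟶ c}
    {xy : a' ⟶ c'} {m : b ⟶ c'} {n : a ⟶ b'} (e₁ : p ≅ fg ≫ t) (e₂ : fg ≅ f ≫ g)
    (e₃ : p ≅ f ≫ m) (e₄ : m ≅ g ≫ t) (e₅ : m ≅ s ≫ y) (e₆ : p ≅ n ≫ y) (e₇ : n ≅ f ≫ s)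
    (e₈ : n ≅ r ≫ x) (e₉ : p ≅ r ≫ xy) (e₁₀ : xy ≅ x ≫ y)
    (h₁ : e₉.hom ≫ r ◁ e₁₀.hom = e₆.hom ≫ e₈.hom ▷ y ≫ (α_ r x y).hom)
    (h₂ : e₃.hom ≫ f ◁ e₅.hom = e₆.hom ≫ e₇.hom ▷ y ≫ (α_ f s y).hom)
    (h₃ : e₃.hom ≫ f ◁ e₄.hom = e₁.hom ≫ e₂.hom ▷ t ≫ (α_ f g t).hom) :
    (e₁.inv ≫ e₉.hom) ≫ r ◁ e₁₀.hom =
      e₂.hom ▷ t ≫ (α_ f g t).hom ≫ f ◁ (e₄.inv ≫ e₅.hom) ≫ (α_ f s y).inv ≫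
        (e₇.inv ≫ e₈.hom) ▷ y ≫ (α_ r x y).hom := by
  have h₂' : f ◁ e₅.hom = e₃.inv ≫ e₆.hom ≫ e₇.hom ▷ y ≫ (α_ f s y).hom := by
    rw [← h₂]; simp
  have h₃' : e₂.hom ▷ t ≫ (α_ f g t).hom = e₁.inv ≫ e₃.hom ≫ f ◁ e₄.hom := by
    rw [h₃]; simp
  rw [Category.assoc, h₁, reassoc_of% h₃', Bicategory.whiskerLeft_comp, h₂']
  simp

/-- The evaluation `k^* : D^K ⟶ D`, given by the functors `(id, k)^* : D(J × K) ⥤ D(J)`. -/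
def eval {K : 𝒦.Obj} (k : K) : D.shift K ⟶ D where
  app J := D.map (op₁ (slot J.unop k))
  naturality {I J} u := (D.mapComp (op₁ (prodMap u.unop K)) (op₁ (slot J.unop k))).symm ≪≫
    D.mapComp (op₁ (slot I.unop k)) u
  naturality_naturality {I J u v} α := by
    have h₁ : D.map₂ (op₂ (prodMap₂ α.unop2 K)) ▷ D.map (op₁ (slot J.unop k)) ≫
        (D.mapComp (op₁ (prodMap v.unop K)) (op₁ (slot J.unop k))).inv =
        (D.mapComp (op₁ (prodMap u.unop K)) (op₁ (slot J.unop k))).inv ≫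
          D.map₂ (op₂ (prodMap₂ α.unop2 K) ▷ op₁ (slot J.unop k)) := by
      rw [D.map₂_whisker_right]; simp
    have h₂ : D.map₂ (op₁ (slot I.unop k) ◁ α) ≫ (D.mapComp (op₁ (slot I.unop k)) v).hom =
        (D.mapComp (op₁ (slot I.unop k)) u).hom ≫ D.map (op₁ (slot I.unop k)) ◁ D.map₂ α := by
      rw [D.map₂_whisker_left]; simp
    exact (Category.assoc _ _ _).symm.trans ((congrArg (· ≫ _) h₁).trans ((Category.assoc _ _ _).trans
      ((congrArg (_ ≫ ·) h₂).trans (Category.assoc _ _ _).symm)))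
  naturality_id J := by
    have h₁ : (D.mapId (op (J.unop.prod K))).hom ▷ D.map (op₁ (slot J.unop k)) ≫
        (λ_ (D.map (op₁ (slot J.unop k)))).hom = (D.mapComp (𝟙 (op (J.unop.prod K))) (op₁ (slot J.unop k))).inv := by
      have := D.map₂_left_unitor (op₁ (slot J.unop k))
      have e : D.map₂ (λ_ (op₁ (slot J.unop k))).hom = 𝟙 (D.map (op₁ (slot J.unop k))) := D.map₂_id _
      refine ((Iso.inv_comp_eq _).mpr this).symm.trans ?_
      rw [e]
      exact Category.comp_id _
    have h₂ : (D.mapComp (op₁ (slot J.unop k)) (𝟙 J)).hom ≫ D.map (op₁ (slot J.unop k)) ◁ (D.mapId J).hom =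
        (ρ_ (D.map (op₁ (slot J.unop k)))).inv := by
      have := D.map₂_right_unitor (op₁ (slot J.unop k))
      have e : D.map₂ (ρ_ (op₁ (slot J.unop k))).hom = 𝟙 (D.map (op₁ (slot J.unop k))) := D.map₂_id _
      rw [e, ← Category.assoc, ← Iso.comp_inv_eq] at this
      exact this.symm.trans (Category.id_comp _)
    exact (Category.assoc _ _ _).trans ((congrArg (_ ≫ ·) h₂).trans
      ((congrArg (· ≫ _) h₁.symm).trans (Category.assoc _ _ _)))
  naturality_comp {I J M} u v := by
    have h₁ := D.mapComp_assoc (op₁ (slot I.unop k)) u v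
    have h₂ := D.mapComp_assoc (op₁ (prodMap u.unop K)) (op₁ (slot J.unop k)) v
    have h₃ := D.mapComp_assoc (op₁ (prodMap u.unop K)) (op₁ (prodMap v.unop K)) (op₁ (slot M.unop k))
    exact eval_aux _ _ (D.mapComp (op₁ (prodMap u.unop K)) (op₁ (prodMap v.unop K) ≫ op₁ (slot M.unop k)))
      _ _ (D.mapComp (op₁ (prodMap u.unop K) ≫ op₁ (slot J.unop k)) v) _ _ _ _ h₁ h₂ h₃

end Prederivator

/-! ### Sub-prederivators -/

/-- A (full) sub-prederivator of `D`: a class of objects in each `D(J)`, stable under the functors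
`u^*`. -/
@[ext]
structure SubPrederivator {𝒦 : DiagramCategory.{w}} (D : Prederivator.{w, v, u} 𝒦) where
  mem : ∀ J : 𝒦.Obj, ObjectProperty (D.on J)
  pull_mem : ∀ {J K : 𝒦.Obj} (u : J ⥤ K) (X : D.on K), mem K X → mem J ((D.pull u).obj X)

namespace SubPrederivator

open DiagramCategory

variable {𝒦 : DiagramCategory.{w}} {D : Prederivator.{w, v, u} 𝒦} (S : SubPrederivator D)

/-- The restriction of a natural transformation to full subcategories. -/
def restrict {J K : 𝒦.Obj} {F G : D.on K ⥤ D.on J} (α : F ⟶ G)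
    (hF : ∀ X : (S.mem K).FullSubcategory, S.mem J (((S.mem K).ι ⋙ F).obj X))
    (hG : ∀ X : (S.mem K).FullSubcategory, S.mem J (((S.mem K).ι ⋙ G).obj X)) :
    (S.mem J).lift ((S.mem K).ι ⋙ F) hF ⟶ (S.mem J).lift ((S.mem K).ι ⋙ G) hG where
  app X := ObjectProperty.homMk (α.app X.obj)
  naturality _ _ f := ObjectProperty.hom_ext _ (α.naturality f.hom)

lemma hom₂_ext {C : Cat.{v, u}} {J : 𝒦.Obj} {F G : C ⟶ Cat.of (S.mem J).FullSubcategory}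
    {α β : F ⟶ G} (h : ∀ X : C, (α.toNatTrans.app X).hom = (β.toNatTrans.app X).hom) : α = β :=
  Cat.Hom₂.ext (NatTrans.ext (funext fun X => ObjectProperty.hom_ext _ (h X)))

/-- A full sub-prederivator regarded as a prederivator. -/
def toPrederivator : Prederivator.{w, v, u} 𝒦 where
  obj J := Cat.of (S.mem J.unop).FullSubcategory
  map {K J} u := Functor.toCatHom ((S.mem J.unop).lift ((S.mem K.unop).ι ⋙ D.pull u.unop)
    (fun X => S.pull_mem u.unop X.obj X.property))
  map₂ α := NatTrans.toCatHom₂ (S.restrict (D.map₂ α).toNatTrans _ _)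
  map₂_id u := S.hom₂_ext fun X =>
    congrArg (fun t => Cat.Hom₂.toNatTrans t |>.app X.obj) (D.map₂_id u)
  map₂_comp α β := S.hom₂_ext fun X =>
    congrArg (fun t => Cat.Hom₂.toNatTrans t |>.app X.obj) (D.map₂_comp α β)
  mapId J := Cat.Hom.isoMk (NatIso.ofComponents
    (fun X => ObjectProperty.isoMk _ ((Cat.Hom.toNatIso (D.mapId J)).app X.obj))
    (fun f => ObjectProperty.hom_ext _ ((D.mapId J).hom.toNatTrans.naturality f.hom)))
  mapComp u v := Cat.Hom.isoMk (NatIso.ofComponents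
    (fun X => ObjectProperty.isoMk _ ((Cat.Hom.toNatIso (D.mapComp u v)).app X.obj))
    (fun f => ObjectProperty.hom_ext _ ((D.mapComp u v).hom.toNatTrans.naturality f.hom)))
  map₂_whisker_left u _ _ α := S.hom₂_ext fun X =>
    congrArg (fun t => Cat.Hom₂.toNatTrans t |>.app X.obj) (D.map₂_whisker_left u α)
  map₂_whisker_right α v := S.hom₂_ext fun X =>
    congrArg (fun t => Cat.Hom₂.toNatTrans t |>.app X.obj) (D.map₂_whisker_right α v)
  map₂_associator u v w := S.hom₂_ext fun X =>
    congrArg (fun t => Cat.Hom₂.toNatTrans t |>.app X.obj) (D.map₂_associator u v w)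
  map₂_left_unitor u := S.hom₂_ext fun X =>
    congrArg (fun t => Cat.Hom₂.toNatTrans t |>.app X.obj) (D.map₂_left_unitor u)
  map₂_right_unitor u := S.hom₂_ext fun X =>
    congrArg (fun t => Cat.Hom₂.toNatTrans t |>.app X.obj) (D.map₂_right_unitor u)

/-- The inclusion of a full sub-prederivator. -/
def incl : S.toPrederivator ⟶ D where
  app J := Functor.toCatHom (D := D.obj J) (S.mem J.unop).ι
  naturality {J I} u := Iso.refl _
  naturality_naturality _ := Cat.Hom₂.ext (NatTrans.ext (funext fun _ =>
    (Category.comp_id _).trans (Category.id_comp _).symm))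
  naturality_id _ := Cat.Hom₂.ext (NatTrans.ext (funext fun _ =>
    (Category.id_comp _).trans ((congrArg (_ ≫ ·) (Category.comp_id _)).trans
      (Category.comp_id _)).symm))
  naturality_comp {_ _ _} u v := Cat.Hom₂.ext (NatTrans.ext (funext fun X => by
    refine (Category.id_comp _).trans ((Category.comp_id _).symm.trans (congrArg (_ ≫ ·) ?_))
    refine Eq.symm ((Category.id_comp _).trans ((Category.id_comp _).trans
      ((Category.id_comp _).trans ((Category.comp_id _).trans ?_))))
    exact (D.map v).toFunctor.map_id _))

end SubPrederivator

namespace Prederivator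

open DiagramCategory

variable {𝒦 : DiagramCategory.{w}} (D : Prederivator.{w, v, u} 𝒦)

/-- The vertex `X_i` in `D(J)` of an object `X` of `D^{[n]}(J) = D(J × [n])`. -/
abbrev vert {J : 𝒦.Obj} {n : ℕ} (i : Fin (n + 1)) : D.on (J.prod (𝒦.ord n)) ⥤ D.on J :=
  D.pull (slot J (𝒦.vertex i))

/-- The edge `X_{(i,j)}` in `D^{[1]}(J)` of an object `X` of `D^{[n]}(J)`. -/
abbrev edge {J : 𝒦.Obj} {n : ℕ} {i j : Fin (n + 1)} (h : i ≤ j) :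
    D.on (J.prod (𝒦.ord n)) ⥤ D.on (J.prod (𝒦.ord 1)) :=
  D.pull (prodMapRight J (𝒦.face h))

/-- The underlying incoherent arrow `dia_{[1]} X : X_0 ⟶ X_1` in `D(J)` of an object `X` of
`D^{[1]}(J)`. -/
abbrev dia {J : 𝒦.Obj} (X : D.on (J.prod (𝒦.ord 1))) : (D.vert 0).obj X ⟶ (D.vert 1).obj X :=
  (D.pull₂ (slotMap J (𝒦.edge (i := 0) (j := 1) (Fin.zero_le _)))).app X

/-! ### Choric reflections -/

/-- A reflection `L ⊣ R : D ⇄ E`: an adjunction in the 2-category of prederivators whose right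
adjoint is fully faithful. -/
structure Reflection where
  E : Prederivator.{w, v, u} 𝒦
  L : D ⟶ E
  R : E ⟶ D
  adj : Bicategory.Adjunction L R
  full : ∀ J : 𝒦.Obj, (R.app (op J)).toFunctor.Full
  faithful : ∀ J : 𝒦.Obj, (R.app (op J)).toFunctor.Faithful

namespace Reflection

variable {D} (r : Reflection D)

/-- The functor `L_J : D(J) ⥤ E(J)`. -/
abbrev left (J : 𝒦.Obj) : D.on J ⥤ r.E.on J := (r.L.app (op J)).toFunctor

/-- The functor `R_J : E(J) ⥤ D(J)`. -/
abbrev right (J : 𝒦.Obj) : r.E.on J ⥤ D.on J := (r.R.app (op J)).toFunctor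

/-- The sub-prederivator `Chr_L ⊆ D^{[1]}` of all `X` such that `X_1` lies in the (essential image
of the) reflective sub-prederivator. -/
def chr : SubPrederivator (D.shift (𝒦.ord 1)) where
  mem J X := (r.right J).essImage ((D.vert 1).obj X)
  pull_mem {J K} u X := by
    rintro ⟨Z, ⟨e⟩⟩
    refine ⟨(r.E.pull u).obj Z, ⟨?_⟩⟩
    exact (Cat.Hom.toNatIso (r.R.naturality (op₁ u))).app Z ≪≫ (D.pull u).mapIso e ≪≫
      ((Cat.Hom.toNatIso ((D.eval (𝒦.vertex (n := 1) 1)).naturality (op₁ u))).app X).symm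

/-- The morphism `R^♯ : Chr_L ⟶ D`, the restriction of the evaluation at `0`. -/
def sharp : r.chr.toPrederivator ⟶ D := r.chr.incl ≫ D.eval (𝒦.vertex (n := 1) 0)

/-- A reflection is choric if `R^♯` has a left adjoint in the 2-category of prederivators. -/
def IsChoric : Prop := Bicategory.IsRightAdjoint r.sharp

/-- The objects `X` of `D^{[1]}(J)` which are inverted by `L`, i.e. such that `dia_{[1]} (L X)` is
an isomorphism. -/
def inverted (J : 𝒦.Obj) : ObjectProperty (D.on (J.prod (𝒦.ord 1))) :=
  fun X => IsIso (r.E.dia ((r.left (J.prod (𝒦.ord 1))).obj X))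

end Reflection

/-- The choric reflections of `D`. -/
def ChoricReflection := {r : Reflection D // r.IsChoric}

/-- Reflections are ordered by inclusion of the essential images of their right adjoints. -/
instance : Preorder (ChoricReflection D) where
  le r r' := ∀ J : 𝒦.Obj, (r.1.right J).essImage ≤ (r'.1.right J).essImage
  le_refl _ _ := le_rfl
  le_trans _ _ _ h h' J := (h J).trans (h' J)

/-- The poset of choric reflections of `D`: two reflections are identified when they are
equivalent, i.e. when their right adjoints have the same essential image. -/
abbrev ChoricReflectionPoset := Antisymmetrization (ChoricReflection D) (· ≤ ·)

/-! ### Prefactorization systems -/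

section Prefactorization

variable [IsDerivator D]

/-- Coherent orthogonality of `X, Y` in `D^{[1]}(J) = D(J × [1])`: for `p : J × [1] ⥤ J` the
projection, the unit `X ⟶ p^* p_! X` induces a bijection `Hom(p^* p_! X, Y) ≅ Hom(X, Y)`. -/
def Orthogonal {J : 𝒦.Obj} (X Y : D.on (J.prod (𝒦.ord 1))) : Prop :=
  Function.Bijective (fun g : (D.pull (fst J (𝒦.ord 1))).obj ((D.lan (fst J (𝒦.ord 1))).obj X) ⟶ Y =>
    (D.lanAdj (fst J (𝒦.ord 1))).unit.app X ≫ g)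

/-- A derivator prefactorization system on `D`: a pair `(E, M)` of sub-prederivators of `D^{[1]}`
such that `E` is the left orthogonal of `M` and `M` is the right orthogonal of `E`. -/
@[ext]
structure PrefactorizationSystem where
  E : SubPrederivator (D.shift (𝒦.ord 1))
  M : SubPrederivator (D.shift (𝒦.ord 1))
  left_orthogonal : ∀ (J : 𝒦.Obj) (X : D.on (J.prod (𝒦.ord 1))),
    E.mem J X ↔ ∀ Y, M.mem J Y → D.Orthogonal X Y
  right_orthogonal : ∀ (J : 𝒦.Obj) (Y : D.on (J.prod (𝒦.ord 1))),
    M.mem J Y ↔ ∀ X, E.mem J X → D.Orthogonal X Y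

/-- The terminal arrow `[X → *]` in `D^{[1]}(J)` of `X` in `D(J)`, given by the right Kan extension
functor `0_* : D(J) ⥤ D(J × [1])`. -/
noncomputable abbrev terminalArrow (J : 𝒦.Obj) : D.on J ⥤ D.on (J.prod (𝒦.ord 1)) :=
  D.ran (slot J (𝒦.vertex (n := 1) 0))

variable {D}

namespace PrefactorizationSystem

variable (F : PrefactorizationSystem D)

/-- The class `D_F(J)` of all `X` in `D(J × [2])` with `X_{(0,1)} ∈ E(J)` and
`X_{(1,2)} ∈ M(J)`. -/
def factorizations (J : 𝒦.Obj) : ObjectProperty (D.on (J.prod (𝒦.ord 2))) := fun X =>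
  F.E.mem J ((D.edge (i := 0) (j := 1) (by decide)).obj X) ∧
    F.M.mem J ((D.edge (i := 1) (j := 2) (by decide)).obj X)

/-- The composition functor `Ψ_F : D_F(J) ⥤ D^{[1]}(J)`, `X ↦ X_{(0,2)}`. -/
abbrev comp (J : 𝒦.Obj) : (F.factorizations J).FullSubcategory ⥤ D.on (J.prod (𝒦.ord 1)) :=
  (F.factorizations J).ι ⋙ D.edge (i := 0) (j := 2) (by decide)

/-- The objects of `D_F(J)` which `Ψ_F` sends to (an isomorphic copy of) a terminal arrow. -/
def terminalFactorizations (J : 𝒦.Obj) : ObjectProperty (F.factorizations J).FullSubcategory :=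
  fun X => (D.terminalArrow J).essImage ((F.comp J).obj X)

/-- `F` is `τ`-choric if `Ψ_F` is fully faithful when restricted to the terminal arrows. -/
structure IsTauChoric : Prop where
  full : ∀ J : 𝒦.Obj, ((F.terminalFactorizations J).ι ⋙ F.comp J).Full
  faithful : ∀ J : 𝒦.Obj, ((F.terminalFactorizations J).ι ⋙ F.comp J).Faithful

/-- `F = (E, M)` is reflective if `E` is a 3-for-2 class and every terminal arrow `[X → *]` has an
`(E, M)`-factorization. -/
structure IsReflective : Prop where
  comp_mem : ∀ (J : 𝒦.Obj) (X : D.on (J.prod (𝒦.ord 2))),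
    F.E.mem J ((D.edge (i := 0) (j := 1) (by decide)).obj X) →
    F.E.mem J ((D.edge (i := 1) (j := 2) (by decide)).obj X) →
    F.E.mem J ((D.edge (i := 0) (j := 2) (by decide)).obj X)
  of_precomp_mem : ∀ (J : 𝒦.Obj) (X : D.on (J.prod (𝒦.ord 2))),
    F.E.mem J ((D.edge (i := 0) (j := 1) (by decide)).obj X) →
    F.E.mem J ((D.edge (i := 0) (j := 2) (by decide)).obj X) →
    F.E.mem J ((D.edge (i := 1) (j := 2) (by decide)).obj X)
  of_postcomp_mem : ∀ (J : 𝒦.Obj) (X : D.on (J.prod (𝒦.ord 2))),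
    F.E.mem J ((D.edge (i := 1) (j := 2) (by decide)).obj X) →
    F.E.mem J ((D.edge (i := 0) (j := 2) (by decide)).obj X) →
    F.E.mem J ((D.edge (i := 0) (j := 1) (by decide)).obj X)
  factor : ∀ (J : 𝒦.Obj) (X : D.on J), ∃ Z : (F.factorizations J).FullSubcategory,
    Nonempty ((F.comp J).obj Z ≅ (D.terminalArrow J).obj X)

end PrefactorizationSystem

/-- Prefactorization systems are ordered by inclusion of their right classes (equivalently, by
reverse inclusion of their left classes). -/
instance : PartialOrder (PrefactorizationSystem D) where
  le F F' := ∀ J : 𝒦.Obj, F.M.mem J ≤ F'.M.mem J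
  le_refl _ _ := le_rfl
  le_trans _ _ _ h h' J := (h J).trans (h' J)
  le_antisymm F F' h h' := by
    have hM : F.M = F'.M := SubPrederivator.ext (funext fun J => le_antisymm (h J) (h' J))
    refine PrefactorizationSystem.ext (SubPrederivator.ext ?_) hM
    funext J X
    exact propext ((F.left_orthogonal J X).trans (by rw [hM]; exact (F'.left_orthogonal J X).symm))

variable (D) in
/-- The poset of reflective, `τ`-choric derivator prefactorization systems on `D`. -/
abbrev ReflectiveTauChoricSystem :=
  {F : PrefactorizationSystem D // F.IsReflective ∧ F.IsTauChoric}

end Prefactorization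

end Prederivator

/-!
The correspondence passes through classes `S` of objects of `D`: a reflection gives the class of its
local objects, a prefactorization system `(E, M)` gives the class of all `Y` with `0_* Y ∈ M`. A
coherent arrow is *acyclic* for `S` if its underlying arrow is inverted by `Hom(-, B)` for all `B`
in `S`; equivalently (`acyclic_iff_orthogonal`), if it is orthogonal to the terminal arrows of the
objects of `S`. A *reflection arrow* is an acyclic arrow with target in `S`. The class `S` is
*choric* (`IsChoricClass`) if it is replete, acyclic arrows are stable under restriction, every
object is the source of a coherent reflection arrow `C`, and `Hom(C, Y) ⟶ Hom(C_0, Y_0)` is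
bijective for every coherent arrow `Y` with target in `S`. Choric reflections and reflective
`τ`-choric prefactorization systems both amount to choric classes.

*Reflections.* A morphism of prederivators has a left adjoint as soon as there are universal arrows
which are stable under restriction (`exists_leftAdjoint`). For a choric class, the reflection arrows
provide these both for the inclusion of `S` and for `R^♯` (`exists_choricReflection`). Conversely,
the left adjoint of `R^♯` sends `X` to a coherent reflection arrow of `X`: its universal property is
tested on terminal arrows, to see that its source is `X`, and on constant arrows, to see that it is
acyclic (`isChoricClass_localObjects`).

*Prefactorization systems.* The acyclic arrows of a choric class are the left class of a
prefactorization system (`acyclicSystem`), because orthogonality satisfies an adjunction formula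
for restriction and left Kan extension (`orthogonal_pull_iff`). Factorizations of terminal arrows
correspond to reflection arrows: an object of `D^{[2]}` with terminal final vertex is the right Kan
extension of its initial edge. Conversely, let `(E, M)` be reflective and `τ`-choric.

* Its left class consists of the acyclic arrows (`IsReflective.E_mem_iff`). Factorizing the terminal
  arrow of an object `X` of `D(J × [1])` gives a coherent square from `X` to an arrow between local
  objects. Its other two sides lie in `E`, and 3-for-2 reduces the claim to the case of an arrow
  between local objects, which is acyclic only if it is invertible.
* Being `τ`-choric gives the bijection `Hom(C, Y) ⟶ Hom(C_0, Y_0)` only for reflection arrows `Y`.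
  To treat an arbitrary arrow `Y` with local target, one reflects `Y` over `J × [1]`. The reflection
  is a coherent square whose diagonal is `Y`, and it yields a morphism from the reflection arrow of
  `Y_0` to `Y` which is the identity on sources (`IsChoricClass.of_bijective`).
-/

namespace CategoryTheory.Bicategory

lemma leftZigzag_eq {C : Type*} [Bicategory C] {a b : C} {f : a ⟶ b} {g : b ⟶ a}
    (η : 𝟙 a ⟶ f ≫ g) (e : g ≫ f ⟶ 𝟙 b) :
    leftZigzag η e = η ▷ f ≫ (α_ _ _ _).hom ≫ f ◁ e := by
  simp [leftZigzag, bicategoricalComp]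

lemma rightZigzag_eq {C : Type*} [Bicategory C] {a b : C} {f : a ⟶ b} {g : b ⟶ a}
    (η : 𝟙 a ⟶ f ≫ g) (e : g ≫ f ⟶ 𝟙 b) :
    rightZigzag η e = g ◁ η ≫ (α_ _ _ _).inv ≫ e ▷ g := by
  simp [rightZigzag, bicategoricalComp]

end CategoryTheory.Bicategory

namespace DiagramCategory

variable {𝒦 : DiagramCategory.{w}}

/-- An adjunction between functors in `Dia`, as an adjunction in the bicategory `Diaᵒᵖ`. Passing to
the opposite exchanges the two adjoints. -/
def opAdjunction {A B : 𝒦.Obj} {s : A ⥤ B} {r : B ⥤ A} (adj : s ⊣ r) :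
    Bicategory.Adjunction (op₁ r) (op₁ s) where
  unit := op₂ (u := 𝟭 A) (v := s ⋙ r) adj.unit
  counit := op₂ (u := r ⋙ s) (v := 𝟭 B) adj.counit
  left_triangle := by
    refine (leftZigzag_eq _ _).trans (congrArg Bicategory.Opposite.op2
      (NatTrans.ext (funext fun b => ?_)))
    refine Eq.trans ?_ ((adj.right_triangle_components b).trans
      (Category.comp_id (𝟙 (r.obj b))).symm)
    exact congrArg (_ ≫ ·) (Category.id_comp (r.map (adj.counit.app b)))
  right_triangle := by
    refine (rightZigzag_eq _ _).trans (congrArg Bicategory.Opposite.op2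
      (NatTrans.ext (funext fun a => ?_)))
    refine Eq.trans ?_ ((adj.left_triangle_components a).trans
      (Category.comp_id (𝟙 (s.obj a))).symm)
    exact congrArg (_ ≫ ·) (Category.id_comp (adj.counit.app (s.obj a)))

end DiagramCategory

namespace Prederivator

open DiagramCategory

variable {𝒦 : DiagramCategory.{w}} (D : Prederivator.{w, v, u} 𝒦)

/-! ### Restriction along functors and natural transformations -/

/-- The natural isomorphism `(𝟭 J)^* ≅ 𝟭`. -/
abbrev pullId (J : 𝒦.Obj) : D.pull (𝟭 J) ≅ 𝟭 (D.on J) :=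
  Cat.Hom.toNatIso (D.mapId (op J))

section

variable {I J K : 𝒦.Obj}

lemma pull₂_id (u : J ⥤ K) : D.pull₂ (𝟙 u) = 𝟙 (D.pull u) :=
  congrArg Cat.Hom₂.toNatTrans (D.map₂_id (op₁ u))

lemma pull₂_comp {u v t : J ⥤ K} (α : u ⟶ v) (β : v ⟶ t) :
    D.pull₂ (α ≫ β) = D.pull₂ α ≫ D.pull₂ β :=
  congrArg Cat.Hom₂.toNatTrans (D.map₂_comp (op₂ α) (op₂ β))

/-- The natural isomorphism `u^* ≅ v^*` induced by `u ≅ v`. -/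
@[simps]
def pullIso {u v : J ⥤ K} (e : u ≅ v) : D.pull u ≅ D.pull v where
  hom := D.pull₂ e.hom
  inv := D.pull₂ e.inv
  hom_inv_id := by rw [← pull₂_comp, e.hom_inv_id, pull₂_id]
  inv_hom_id := by rw [← pull₂_comp, e.inv_hom_id, pull₂_id]

lemma pull₂_whiskerLeft (t : I ⥤ J) {u v : J ⥤ K} (α : u ⟶ v) (X : D.on K) :
    (D.pull₂ (Functor.whiskerLeft t α)).app X ≫ (D.pullComp t v).hom.app X =
      (D.pullComp t u).hom.app X ≫ (D.pull t).map ((D.pull₂ α).app X) := by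
  have h := congrArg (fun γ => γ.toNatTrans.app X) (D.map₂_whisker_right (op₂ α) (op₁ t))
  refine (congrArg (· ≫ _) h).trans ?_
  refine (Category.assoc _ _ _).trans (congrArg (_ ≫ ·) ?_)
  refine (Category.assoc _ _ _).trans ((congrArg (_ ≫ ·) ?_).trans (Category.comp_id _))
  exact (D.pullComp t v).inv_hom_id_app X

lemma pull₂_whiskerRight {u v : I ⥤ J} (α : u ⟶ v) (t : J ⥤ K) (X : D.on K) :
    (D.pull₂ (Functor.whiskerRight α t)).app X ≫ (D.pullComp v t).hom.app X =
      (D.pullComp u t).hom.app X ≫ (D.pull₂ α).app ((D.pull t).obj X) := by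
  have h := congrArg (fun γ => γ.toNatTrans.app X) (D.map₂_whisker_left (op₁ t) (op₂ α))
  refine (congrArg (· ≫ _) h).trans ?_
  refine (Category.assoc _ _ _).trans (congrArg (_ ≫ ·) ?_)
  refine (Category.assoc _ _ _).trans ((congrArg (_ ≫ ·) ?_).trans (Category.comp_id _))
  exact (D.pullComp v t).inv_hom_id_app X

/-- The arrow `u^* X ⟶ v^* X` induced by `α : u ⟶ v`, as an object of the arrow category. -/
abbrev pullArrow {u v : J ⥤ K} (α : u ⟶ v) (X : D.on K) : Arrow (D.on J) :=
  Arrow.mk ((D.pull₂ α).app X)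

/-- The functor which sends `X` to the arrow `u^* X ⟶ v^* X` induced by `α : u ⟶ v`. -/
@[simps]
def pullArrowFunctor {u v : J ⥤ K} (α : u ⟶ v) : D.on K ⥤ Arrow (D.on J) where
  obj X := D.pullArrow α X
  map f := Arrow.homMk ((D.pull u).map f) ((D.pull v).map f) ((D.pull₂ α).naturality f)

/-- Restriction of the arrow induced by `α` along `t` is the arrow induced by `t ◁ α`. -/
def mapPullArrowIso (t : I ⥤ J) {u v : J ⥤ K} (α : u ⟶ v) (X : D.on K) :
    D.pullArrow (Functor.whiskerLeft t α) X ≅ (D.pull t).mapArrow.obj (D.pullArrow α X) :=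
  Arrow.isoMk ((D.pullComp t u).app X) ((D.pullComp t v).app X)
    (D.pull₂_whiskerLeft t α X).symm

/-- The arrow induced by `α` on a restriction `t^* X` is the arrow induced by `α ▷ t`. -/
def pullArrowPullIso {u v : I ⥤ J} (α : u ⟶ v) (t : J ⥤ K) (X : D.on K) :
    D.pullArrow (Functor.whiskerRight α t) X ≅ D.pullArrow α ((D.pull t).obj X) :=
  Arrow.isoMk ((D.pullComp u t).app X) ((D.pullComp v t).app X)
    (D.pull₂_whiskerRight α t X).symm

/-- Isomorphic 2-cells induce isomorphic arrows. -/
def pullArrowCongr {u v u' v' : J ⥤ K} (α : u ⟶ v) (β : u' ⟶ v') (e : u ≅ u') (e' : v ≅ v')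
    (h : e.hom ≫ β = α ≫ e'.hom) (X : D.on K) : D.pullArrow α X ≅ D.pullArrow β X :=
  Arrow.isoMk ((D.pullIso e).app X) ((D.pullIso e').app X) (by
    have := congrArg (fun γ => (D.pull₂ γ).app X) h
    simp only [pull₂_comp] at this
    exact this)

/-- Adjoint functors `s ⊣ r` restrict to adjoint functors `r^* ⊣ s^*`. -/
def pullAdjunction {s : J ⥤ K} {r : K ⥤ J} (adj : s ⊣ r) : D.pull r ⊣ D.pull s :=
  CategoryTheory.Adjunction.ofCat (D.mapAdjunction (opAdjunction adj))

/-- The natural isomorphism `v^* ⋙ u^* ≅ t^*` induced by `u ⋙ v ≅ t`. -/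
def pullCompIso {u : I ⥤ J} {v : J ⥤ K} {t : I ⥤ K} (e : u ⋙ v ≅ t) :
    D.pull v ⋙ D.pull u ≅ D.pull t :=
  (D.pullComp u v).symm ≪≫ D.pullIso e

end

end Prederivator

namespace DiagramCategory

variable {𝒦 : DiagramCategory.{w}}

/-! ### Adjunctions between the shapes `J × [n]` -/

/-- There is at most one arrow between two objects of `[n]`. -/
lemma ord_hom_subsingleton {n : ℕ} {a b : 𝒦.ord n} (f g : a ⟶ b) : f = g :=
  have : Subsingleton (a ⟶ b) :=
    inferInstanceAs (Subsingleton (ULift.{w} (PLift (@LE.le (Chain.{w} (n + 1)) _ a b))))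
  Subsingleton.elim f g

/-- An arrow of `[n]` given by an inequality. -/
def ordHom {n : ℕ} {a b : 𝒦.ord n} (h : @LE.le (Chain.{w} (n + 1)) _ a b) : a ⟶ b :=
  homOfLE (X := Chain.{w} (n + 1)) h

lemma ord_le {n : ℕ} {a b : 𝒦.ord n} (f : a ⟶ b) : (ULift.down a : Fin (n + 1)) ≤ ULift.down b :=
  leOfHom (X := Chain.{w} (n + 1)) f

variable (J : 𝒦.Obj)

/-- The inclusion at the initial vertex is left adjoint to the projection `J × [1] ⥤ J`. -/
def slotZeroAdjunction : slot J (𝒦.vertex (n := 1) 0) ⊣ fst J (𝒦.ord 1) where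
  unit := 𝟙 (𝟭 J)
  counit :=
    { app x := (𝟙 x.1, ordHom (Fin.zero_le (n := 2) (ULift.down x.2 : Fin 2)))
      naturality _ _ _ := Prod.ext ((Category.comp_id _).trans (Category.id_comp _).symm)
        (ord_hom_subsingleton _ _) }
  left_triangle_components _ := Prod.ext (Category.comp_id _) (ord_hom_subsingleton _ _)
  right_triangle_components _ := Category.comp_id _

/-- The projection `J × [1] ⥤ J` is left adjoint to the inclusion at the final vertex. -/
def fstAdjunction : fst J (𝒦.ord 1) ⊣ slot J (𝒦.vertex (n := 1) 1) where
  unit :=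
    { app x := (𝟙 x.1, ordHom (Fin.le_last (n := 1) (ULift.down x.2 : Fin 2)))
      naturality _ _ _ := Prod.ext ((Category.comp_id _).trans (Category.id_comp _).symm)
        (ord_hom_subsingleton _ _) }
  counit := 𝟙 (𝟭 J)
  left_triangle_components _ := Category.comp_id _
  right_triangle_components _ := Prod.ext (Category.comp_id _) (ord_hom_subsingleton _ _)

/-- The monotone map `[2] ⥤ [1]` with `0 ↦ 0`, `1 ↦ 1`, `2 ↦ 1`. -/
def truncate (𝒦 : DiagramCategory.{w}) : 𝒦.ord 2 ⥤ 𝒦.ord 1 :=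
  Monotone.functor (X := Chain.{w} 3) (Y := Chain.{w} 2)
    (f := fun x => ULift.up (if ULift.down x = 0 then 0 else 1)) (by
      rintro ⟨x⟩ ⟨y⟩ hxy
      change (if x = 0 then 0 else 1 : Fin 2) ≤ (if y = 0 then 0 else 1)
      have hxy' : x ≤ y := hxy
      clear hxy
      revert x y
      decide)

/-- The inclusion `J × [1] ⥤ J × [2]` of the initial edge. -/
abbrev initialFace : J.prod (𝒦.ord 1) ⥤ J.prod (𝒦.ord 2) :=
  prodMapRight J (𝒦.face (n := 2) (i := 0) (j := 1) (by decide))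

/-- The inclusion `J × [1] ⥤ J × [2]` of the initial edge is a left adjoint. -/
def initialFaceAdjunction :
    initialFace J ⊣ prodMapRight J (truncate 𝒦) where
  unit :=
    { app x := (𝟙 x.1, ordHom (by
        obtain ⟨j, ⟨a⟩⟩ := x
        change a ≤ if (if a = 0 then 0 else 1 : Fin 3) = 0 then 0 else 1
        revert a
        decide))
      naturality _ _ _ := Prod.ext ((Category.comp_id _).trans (Category.id_comp _).symm)
        (ord_hom_subsingleton _ _) }
  counit :=
    { app x := (𝟙 x.1, ordHom (by
        obtain ⟨j, ⟨a⟩⟩ := x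
        change (if (if a = 0 then 0 else 1 : Fin 2) = 0 then 0 else 1) ≤ a
        revert a
        decide))
      naturality _ _ _ := Prod.ext ((Category.comp_id _).trans (Category.id_comp _).symm)
        (ord_hom_subsingleton _ _) }
  left_triangle_components _ := Prod.ext (Category.comp_id _) (ord_hom_subsingleton _ _)
  right_triangle_components _ := Prod.ext (Category.comp_id _) (ord_hom_subsingleton _ _)

instance : (slot J (𝒦.vertex (n := 1) 0)).Full where
  map_surjective f := ⟨f.1, Prod.ext rfl (ord_hom_subsingleton _ _)⟩

instance : (slot J (𝒦.vertex (n := 1) 0)).Faithful where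
  map_injective h := congrArg Prod.fst h

instance : (initialFace J).Full where
  map_surjective {x y} f := ⟨(f.1, ordHom (by
    have h := ord_le f.2
    obtain ⟨j, ⟨a⟩⟩ := x
    obtain ⟨k, ⟨b⟩⟩ := y
    change (if a = 0 then 0 else 1 : Fin 3) ≤ if b = 0 then 0 else 1 at h
    change a ≤ b
    clear f
    revert a b
    decide)), Prod.ext rfl (ord_hom_subsingleton _ _)⟩

instance : (initialFace J).Faithful where
  map_injective h := Prod.ext (congrArg (fun f => f.1) h :) (ord_hom_subsingleton _ _)

end DiagramCategory

namespace Prederivator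

open DiagramCategory

variable {𝒦 : DiagramCategory.{w}} (D : Prederivator.{w, v, u} 𝒦) [IsDerivator D]

/-! ### Terminal objects and pointwise detection -/

variable {D} in
/-- The functors `u^*` preserve terminal objects, being right adjoints. -/
lemma isTerminal_pull {J K : 𝒦.Obj} (u : J ⥤ K) {X : D.on K}
    (h : Nonempty (Limits.IsTerminal X)) : Nonempty (Limits.IsTerminal ((D.pull u).obj X)) := by
  obtain ⟨h⟩ := h
  have := (D.lanAdj u).rightAdjoint_preservesLimits.{0, 0}
  exact ⟨h.isTerminalObj (D.pull u)⟩

/-- All objects of `D(I)` are terminal if `I` is empty. -/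
lemma isTerminal_of_isEmpty (I : 𝒦.Obj) [IsEmpty I] (X : D.on I) :
    Nonempty (Limits.IsTerminal X) := by
  have : IsEmpty (𝒦.empty : 𝒦.Obj) := inferInstanceAs (IsEmpty (ULift.{w} (Fin 0)))
  let a : I ⥤ 𝒦.empty :=
    { obj x := isEmptyElim x, map {x} := isEmptyElim x, map_id x := isEmptyElim x,
      map_comp {x} := isEmptyElim x }
  let b : 𝒦.empty ⥤ I :=
    { obj x := isEmptyElim x, map {x} := isEmptyElim x, map_id x := isEmptyElim x,
      map_comp {x} := isEmptyElim x }
  let e : a ⋙ b ≅ 𝟭 I := NatIso.ofComponents (fun x => isEmptyElim x) (fun {x} => isEmptyElim x)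
  let i : D.pull b ⋙ D.pull a ≅ 𝟭 (D.on I) := D.pullCompIso e ≪≫ D.pullId I
  have hF : (D.pull b).Faithful := Functor.Faithful.of_comp_iso i
  have hE := IsDerivator.der1_empty (D := D)
  have hm (A B : D.on 𝒦.empty) : Nonempty (A ⟶ B) :=
    ⟨((Functor.const (D.on 𝒦.empty)).obj (Discrete.mk PUnit.unit) :
      D.on 𝒦.empty ⥤ Discrete PUnit.{1}).preimage (𝟙 _)⟩
  have hs (A B : D.on 𝒦.empty) (f g : A ⟶ B) : f = g :=
    ((Functor.const (D.on 𝒦.empty)).obj (Discrete.mk PUnit.unit) :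
      D.on 𝒦.empty ⥤ Discrete PUnit.{1}).map_injective rfl
  exact ⟨Limits.IsTerminal.ofUniqueHom
    (fun Y => i.inv.app Y ≫ (D.pull a).map (hm _ _).some ≫ i.hom.app X)
    (fun Y m => (D.pull b).map_injective (hs _ _ _ _))⟩

/-- If `b/u` is empty, the value of `u_* X` at `b` is the limit of an empty diagram. -/
lemma isTerminal_point_ran {A B : 𝒦.Obj} (u : A ⥤ B) (b : B) [IsEmpty (StructuredArrow b u)]
    (X : D.on A) : Nonempty (Limits.IsTerminal ((D.pull (point b)).obj ((D.ran u).obj X))) := by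
  have : IsEmpty (sliceUnder u b) := inferInstanceAs (IsEmpty (StructuredArrow b u))
  have h := IsDerivator.der4_ran (D := D) u b (D.ranAdj u) (D.ranAdj (toPt (sliceUnder u b)))
  obtain ⟨t⟩ := D.isTerminal_of_isEmpty (sliceUnder u b) ((D.pull (sliceUnderProj u b)).obj X)
  have := (D.ranAdj (toPt (sliceUnder u b))).rightAdjoint_preservesLimits.{0, 0}
  exact ⟨(t.isTerminalObj (D.ran (toPt (sliceUnder u b)))).ofIso (asIso ((mateEquiv (D.ranAdj u)
    (D.ranAdj (toPt (sliceUnder u b)))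
    (.mk _ _ _ _ (D.square (sliceUnderCell u b)))).natTrans.app X)).symm⟩

/-- Every category `D(J)` has a terminal object, the right Kan extension from the empty diagram. -/
lemma exists_isTerminal (J : 𝒦.Obj) : ∃ T : D.on J, Nonempty (Limits.IsTerminal T) := by
  have : IsEmpty (𝒦.empty : 𝒦.Obj) := inferInstanceAs (IsEmpty (ULift.{w} (Fin 0)))
  let a : 𝒦.empty ⥤ J :=
    { obj x := isEmptyElim x, map {x} := isEmptyElim x, map_id x := isEmptyElim x,
      map_comp {x} := isEmptyElim x }
  have hE := IsDerivator.der1_empty (D := D)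
  obtain ⟨t⟩ := D.isTerminal_of_isEmpty 𝒦.empty
    (((Functor.const (D.on 𝒦.empty)).obj (Discrete.mk PUnit.unit) :
      D.on 𝒦.empty ⥤ Discrete PUnit.{1}).objPreimage (Discrete.mk PUnit.unit))
  have := (D.ranAdj a).rightAdjoint_preservesLimits.{0, 0}
  exact ⟨_, ⟨t.isTerminalObj (D.ran a)⟩⟩

variable {D} in
/-- A morphism between terminal objects is invertible. -/
lemma isIso_of_isTerminal {C : Type*} [Category* C] {X Y : C}
    (hX : Nonempty (Limits.IsTerminal X)) (hY : Nonempty (Limits.IsTerminal Y)) (f : X ⟶ Y) :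
    IsIso f :=
  ⟨hX.some.from Y, hX.some.hom_ext _ _, hY.some.hom_ext _ _⟩

variable {D} in
/-- Terminal objects are detected pointwise. -/
lemma isTerminal_of_point {J : 𝒦.Obj} {X : D.on J}
    (h : ∀ j : J, Nonempty (Limits.IsTerminal ((D.pull (point j)).obj X))) :
    Nonempty (Limits.IsTerminal X) := by
  obtain ⟨T, ⟨t⟩⟩ := D.exists_isTerminal J
  have : IsIso (t.from X) := IsDerivator.der2 J _ fun j =>
    isIso_of_isTerminal (h j) (isTerminal_pull _ ⟨t⟩) _
  exact ⟨t.ofIso (asIso (t.from X)).symm⟩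

variable {D} in
/-- Isomorphisms are detected on the vertices. -/
lemma isIso_of_slot {J K : 𝒦.Obj} {X Y : D.on (J.prod K)} (f : X ⟶ Y)
    (h : ∀ k : K, IsIso ((D.pull (slot J k)).map f)) : IsIso f := by
  refine IsDerivator.der2 _ f fun x => ?_
  have := h x.2
  exact (NatIso.isIso_map_iff (D.pullCompIso (u := point x.1) (v := slot J x.2) (t := point x)
    (NatIso.ofComponents (fun _ => Iso.refl _) (fun _ => Prod.ext rfl rfl))) f).1
    (inferInstanceAs (IsIso ((D.pull (point x.1)).map ((D.pull (slot J x.2)).map f))))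

/-! ### Right Kan extension along fully faithful functors with a right adjoint -/

section

variable {A B : 𝒦.Obj} {s : A ⥤ B} {r : B ⥤ A} [s.Full] [s.Faithful]

/-- The counit `s^* s_* ⟶ id` is invertible, since `r^* ⊣ s^* ⊣ s_*` and `r^*` is fully faithful. -/
lemma isIso_ranAdj_counit (adj : s ⊣ r) : IsIso (D.ranAdj s).counit := by
  let t : CategoryTheory.Adjunction.Triple (D.pull r) (D.pull s) (D.ran s) :=
    ⟨D.pullAdjunction adj, D.ranAdj s⟩
  refine t.isIso_unit_iff_isIso_counit.1 ?_
  exact t.adj₁.isIso_unit_of_iso (D.pullCompIso (asIso adj.unit).symm ≪≫ D.pullId A)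

/-- The unit `W ⟶ s_* s^* W` is invertible if `W` is terminal outside of the image of `s`, provided
that no object of `B` outside of this image maps to it. -/
lemma isIso_ranAdj_unit_app (adj : s ⊣ r) {W : D.on B}
    (h : ∀ b : B, (∃ a, s.obj a = b) ∨ (IsEmpty (StructuredArrow b s) ∧
      Nonempty (Limits.IsTerminal ((D.pull (point b)).obj W)))) :
    IsIso ((D.ranAdj s).unit.app W) := by
  have := D.isIso_ranAdj_counit adj
  refine IsDerivator.der2 _ _ fun b => ?_
  rcases h b with ⟨a, rfl⟩ | ⟨h₁, h₂⟩
  · have h₁ : IsIso ((D.pull s).map ((D.ranAdj s).unit.app W)) := by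
      rw [IsIso.eq_inv_of_inv_hom_id ((D.ranAdj s).left_triangle_components W)]
      infer_instance
    exact (NatIso.isIso_map_iff (D.pullCompIso (u := point a) (v := s) (t := point (s.obj a))
      (NatIso.ofComponents (fun _ => Iso.refl _) (fun f => by
        refine (Category.comp_id _).trans ((s.map_id a).trans (Category.id_comp _).symm)))) _).1
      (inferInstanceAs (IsIso ((D.pull (point a)).map ((D.pull s).map _))))
  · exact isIso_of_isTerminal h₂ (D.isTerminal_point_ran s b _) _

variable {D} in
/-- If the unit `W ⟶ s_* s^* W` is invertible, morphisms into `W` are the same as morphisms between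
the restrictions along `s`. -/
lemma pull_map_bijective {A B : 𝒦.Obj} (s : A ⥤ B) {W : D.on B}
    (h : IsIso ((D.ranAdj s).unit.app W)) (Z : D.on B) :
    Function.Bijective (fun f : Z ⟶ W => (D.pull s).map f) := by
  have e (f : Z ⟶ W) : (D.ranAdj s).homEquiv Z _ ((D.pull s).map f) =
      f ≫ (D.ranAdj s).unit.app W := by
    rw [CategoryTheory.Adjunction.homEquiv_unit]
    exact ((D.ranAdj s).unit.naturality f).symm
  refine (Function.Bijective.of_comp_iff' ((D.ranAdj s).homEquiv Z _).bijective _).1 ?_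
  refine ⟨fun f g hfg => ?_, fun g => ⟨g ≫ inv ((D.ranAdj s).unit.app W), ?_⟩⟩
  · simpa only [Function.comp_apply, e, cancel_mono] using hfg
  · rw [Function.comp_apply, e, Category.assoc, IsIso.inv_hom_id, Category.comp_id]

end

end Prederivator

namespace Prederivator

open DiagramCategory

variable {𝒦 : DiagramCategory.{w}} (D : Prederivator.{w, v, u} 𝒦)

/-! ### Vertices, edges and underlying arrows -/

section

variable {J K : 𝒦.Obj}

/-- The vertex of the restriction `u^* X` is the restriction of the vertex of `X`. -/
def prodMapSlotIso (u : J ⥤ K) {A : 𝒦.Obj} (a : A) :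
    D.pull (prodMap u A) ⋙ D.pull (slot J a) ≅ D.pull (slot K a) ⋙ D.pull u :=
  D.pullCompIso (u := slot J a) (v := prodMap u A) (t := u ⋙ slot K a) (Iso.refl _) ≪≫
    D.pullComp u (slot K a)

/-- The source of the edge `X_{(i,j)}` is `X_i`. -/
def edgeVertZeroIso (J : 𝒦.Obj) {n : ℕ} {i j : Fin (n + 1)} (h : i ≤ j) :
    D.edge (J := J) h ⋙ D.vert 0 ≅ D.vert i :=
  D.pullCompIso (Iso.refl (slot J (𝒦.vertex i)))

/-- The target of the edge `X_{(i,j)}` is `X_j`. -/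
def edgeVertOneIso (J : 𝒦.Obj) {n : ℕ} {i j : Fin (n + 1)} (h : i ≤ j) :
    D.edge (J := J) h ⋙ D.vert 1 ≅ D.vert j :=
  D.pullCompIso (Iso.refl (slot J (𝒦.vertex j)))

/-- The arrow underlying the edge `X_{(i,j)}` is the structure map `X_i ⟶ X_j`. -/
def edgeDiaIso {n : ℕ} {i j : Fin (n + 1)} (h : i ≤ j) (X : D.on (J.prod (𝒦.ord n))) :
    Arrow.mk (D.dia ((D.edge h).obj X)) ≅ D.pullArrow (slotMap J (𝒦.edge h)) X :=
  (D.pullArrowPullIso (slotMap J (𝒦.edge (i := 0) (j := 1) (Fin.zero_le _)))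
    (prodMapRight J (𝒦.face h)) X).symm

/-- The arrow underlying `u^* X` is the image under `u^*` of the arrow underlying `X`. -/
def prodMapDiaIso (u : J ⥤ K) (X : D.on (K.prod (𝒦.ord 1))) :
    Arrow.mk (D.dia ((D.pull (prodMap u (𝒦.ord 1))).obj X)) ≅
      (D.pull u).mapArrow.obj (Arrow.mk (D.dia X)) :=
  (D.pullArrowPullIso (slotMap J (𝒦.edge (i := 0) (j := 1) (Fin.zero_le _)))
      (prodMap u (𝒦.ord 1)) X).symm ≪≫
    D.pullArrowCongr (u := slot J (𝒦.vertex (n := 1) 0) ⋙ prodMap u (𝒦.ord 1))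
      (v := slot J (𝒦.vertex (n := 1) 1) ⋙ prodMap u (𝒦.ord 1))
      (Functor.whiskerRight (slotMap J (𝒦.edge (i := 0) (j := 1) (Fin.zero_le _)))
        (prodMap u (𝒦.ord 1)))
      (Functor.whiskerLeft u (slotMap K (𝒦.edge (n := 1) (i := 0) (j := 1) (Fin.zero_le _))))
      (u' := u ⋙ slot K (𝒦.vertex (n := 1) 0)) (v' := u ⋙ slot K (𝒦.vertex (n := 1) 1))
      (Iso.refl _) (Iso.refl _)
      (NatTrans.ext (funext fun x => Prod.ext
        ((Category.id_comp (𝟙 (u.obj x))).trans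
          (((Category.comp_id _).trans (u.map_id x)).symm))
        (ord_hom_subsingleton _ _))) X ≪≫
    D.mapPullArrowIso u (slotMap K (𝒦.edge (n := 1) (i := 0) (j := 1) (Fin.zero_le _))) X

/-- The functor which sends a coherent arrow to its underlying arrow. -/
abbrev diaFunctor (J : 𝒦.Obj) : D.on (J.prod (𝒦.ord 1)) ⥤ Arrow (D.on J) :=
  D.pullArrowFunctor (slotMap J (𝒦.edge (i := 0) (j := 1) (Fin.zero_le _)))

variable {D}

lemma dia_naturality {X Y : D.on (J.prod (𝒦.ord 1))} (f : X ⟶ Y) :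
    (D.vert 0).map f ≫ D.dia Y = D.dia X ≫ (D.vert 1).map f :=
  (D.pull₂ (slotMap J (𝒦.edge (i := 0) (j := 1) (Fin.zero_le _)))).naturality f

lemma isIso_dia_congr {X Y : D.on (J.prod (𝒦.ord 1))} (e : X ≅ Y) :
    IsIso (D.dia X) ↔ IsIso (D.dia Y) :=
  (MorphismProperty.isomorphisms _).arrow_mk_iso_iff ((D.diaFunctor J).mapIso e)

lemma isIso_pull₂ {u v : J ⥤ K} (α : u ⟶ v) [IsIso α] : IsIso (D.pull₂ α) :=
  (D.pullIso (asIso α)).isIso_hom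

lemma isIso_dia_pull_fst (A : D.on J) : IsIso (D.dia ((D.pull (fst J (𝒦.ord 1))).obj A)) := by
  have : IsIso (Functor.whiskerRight
      (slotMap J (𝒦.edge (n := 1) (i := 0) (j := 1) (Fin.zero_le _))) (fst J (𝒦.ord 1))) :=
    (NatIso.ofComponents (F := slot J (𝒦.vertex (n := 1) 0) ⋙ fst J (𝒦.ord 1))
      (G := slot J (𝒦.vertex (n := 1) 1) ⋙ fst J (𝒦.ord 1)) (fun x => Iso.refl x)
      (fun f => (Category.comp_id f).trans (Category.id_comp f).symm)).isIso_hom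
  have := isIso_pull₂ (D := D) (Functor.whiskerRight
      (slotMap J (𝒦.edge (n := 1) (i := 0) (j := 1) (Fin.zero_le _))) (fst J (𝒦.ord 1)))
  exact ((MorphismProperty.isomorphisms _).arrow_mk_iso_iff (D.pullArrowPullIso
    (slotMap J (𝒦.edge (n := 1) (i := 0) (j := 1) (Fin.zero_le _))) (fst J (𝒦.ord 1)) A)).1
      (NatIso.isIso_app_of_isIso _ A)

variable [IsDerivator D]

lemma isIso_of_vert {n : ℕ} {X Y : D.on (J.prod (𝒦.ord n))} (f : X ⟶ Y)
    (h : ∀ i : Fin (n + 1), IsIso ((D.vert i).map f)) : IsIso f :=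
  isIso_of_slot f fun k => h (ULift.down k)

/-- A morphism between arrows which are isomorphisms is invertible if it is so on targets. -/
lemma isIso_of_isIso_dia {X Y : D.on (J.prod (𝒦.ord 1))} (f : X ⟶ Y) (hX : IsIso (D.dia X))
    (hY : IsIso (D.dia Y)) (h : IsIso ((D.vert 1).map f)) : IsIso f := by
  refine isIso_of_vert f fun i => ?_
  match i with
  | 0 => exact IsIso.of_isIso_fac_right (dia_naturality f)
  | 1 => exact h

/-! ### Terminal arrows -/

/-- Right Kan extension along `s` is terminal at a vertex from which nothing maps to the image of
`s`. -/
lemma isTerminal_vert_ran {A : 𝒦.Obj} {n : ℕ} (s : A ⥤ J.prod (𝒦.ord n)) (i : Fin (n + 1))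
    (h : ∀ j : J, IsEmpty (StructuredArrow (C := A) (D := J.prod (𝒦.ord n)) (j, 𝒦.vertex i) s))
    (X : D.on A) : Nonempty (Limits.IsTerminal ((D.vert i).obj ((D.ran s).obj X))) := by
  refine isTerminal_of_point fun j => ?_
  have := h j
  obtain ⟨t⟩ := D.isTerminal_point_ran s (j, 𝒦.vertex i) X
  refine ⟨t.ofIso ((D.pullCompIso (u := point j) (v := slot J (𝒦.vertex i))
    (t := point (J := J.prod (𝒦.ord n)) (j, 𝒦.vertex i))
    (NatIso.ofComponents (fun _ => Iso.refl _) (fun _ => Prod.ext rfl rfl))).symm.app _)⟩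

lemma isTerminal_point_of_vert {n : ℕ} {i : Fin (n + 1)} {X : D.on (J.prod (𝒦.ord n))}
    (h : Nonempty (Limits.IsTerminal ((D.vert i).obj X))) (j : J) :
    Nonempty (Limits.IsTerminal
      ((D.pull (point (J := J.prod (𝒦.ord n)) (j, 𝒦.vertex i))).obj X)) :=
  ⟨(isTerminal_pull (point j) h).some.ofIso ((D.pullCompIso (u := point j)
    (v := slot J (𝒦.vertex i)) (t := point (J := J.prod (𝒦.ord n)) (j, 𝒦.vertex i))
    (NatIso.ofComponents (fun _ => Iso.refl _) (fun _ => Prod.ext rfl rfl))).app _)⟩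

lemma isEmpty_structuredArrow_slot (j : J) : IsEmpty (StructuredArrow (C := J)
    (D := J.prod (𝒦.ord 1)) (j, 𝒦.vertex 1) (slot J (𝒦.vertex (n := 1) 0))) :=
  ⟨fun f => absurd (ord_le f.hom.2) (show ¬ (1 : Fin 2) ≤ 0 by decide)⟩

lemma isEmpty_structuredArrow_face (j : J) : IsEmpty (StructuredArrow (C := J.prod (𝒦.ord 1))
    (D := J.prod (𝒦.ord 2)) (j, 𝒦.vertex 2) (initialFace J)) :=
  ⟨fun f => absurd (ord_le f.hom.2) (by
    obtain ⟨-, ⟨k, ⟨a⟩⟩, f⟩ := f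
    change ¬ (2 : Fin 3) ≤ if a = 0 then 0 else 1
    clear f
    revert a
    decide)⟩

/-- The target of a terminal arrow is terminal. -/
lemma isTerminal_vert_terminalArrow (X : D.on J) :
    Nonempty (Limits.IsTerminal ((D.vert 1).obj ((D.terminalArrow J).obj X))) :=
  isTerminal_vert_ran _ _ isEmpty_structuredArrow_slot X

/-- The source of the terminal arrow of `X` is `X`. -/
noncomputable def terminalArrowVertIso (X : D.on J) :
    (D.vert 0).obj ((D.terminalArrow J).obj X) ≅ X :=
  have := D.isIso_ranAdj_counit (slotZeroAdjunction J)
  (asIso (D.ranAdj (slot J (𝒦.vertex (n := 1) 0))).counit).app X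

/-- The unit `X ⟶ 0_* X_0` is invertible on arrows with terminal target. -/
lemma isIso_terminalArrow_unit {X : D.on (J.prod (𝒦.ord 1))}
    (h : Nonempty (Limits.IsTerminal ((D.vert 1).obj X))) :
    IsIso ((D.ranAdj (slot J (𝒦.vertex (n := 1) 0))).unit.app X) := by
  refine D.isIso_ranAdj_unit_app (slotZeroAdjunction J) fun b => ?_
  obtain ⟨j, ⟨a⟩⟩ := b
  match a with
  | 0 => exact Or.inl ⟨j, rfl⟩
  | 1 => exact Or.inr ⟨isEmpty_structuredArrow_slot j, isTerminal_point_of_vert h j⟩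

/-- An object of `D^{[2]}` with terminal final vertex is determined by its initial edge. -/
lemma isIso_initialFace_unit {X : D.on (J.prod (𝒦.ord 2))}
    (h : Nonempty (Limits.IsTerminal ((D.vert 2).obj X))) :
    IsIso ((D.ranAdj (initialFace J)).unit.app X) := by
  refine D.isIso_ranAdj_unit_app (initialFaceAdjunction J) fun b => ?_
  obtain ⟨j, ⟨a⟩⟩ := b
  match a with
  | 0 => exact Or.inl ⟨(j, 𝒦.vertex 0), rfl⟩
  | 1 => exact Or.inl ⟨(j, 𝒦.vertex 1), rfl⟩
  | 2 => exact Or.inr ⟨isEmpty_structuredArrow_face j, isTerminal_point_of_vert h j⟩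

/-- The extension `[X_0 ⟶ X_1 ⟶ *]` of an arrow `X_0 ⟶ X_1`. -/
noncomputable abbrev extend (J : 𝒦.Obj) : D.on (J.prod (𝒦.ord 1)) ⥤ D.on (J.prod (𝒦.ord 2)) :=
  D.ran (initialFace J)

lemma isTerminal_vert_extend (X : D.on (J.prod (𝒦.ord 1))) :
    Nonempty (Limits.IsTerminal ((D.vert 2).obj ((extend J).obj X))) :=
  isTerminal_vert_ran _ _ isEmpty_structuredArrow_face X

/-- The initial edge of the extension of an arrow `X` is `X`. -/
noncomputable def edgeExtendIso (X : D.on (J.prod (𝒦.ord 1))) :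
    (D.edge (i := 0) (j := 1) (by decide)).obj ((extend J).obj X) ≅ X :=
  have := D.isIso_ranAdj_counit (initialFaceAdjunction J)
  (asIso (D.ranAdj (initialFace J)).counit).app X

/-- An arrow with terminal target is isomorphic to the terminal arrow of its source. -/
noncomputable def isoTerminalArrow {X : D.on (J.prod (𝒦.ord 1))}
    (h : Nonempty (Limits.IsTerminal ((D.vert 1).obj X))) :
    X ≅ (D.terminalArrow J).obj ((D.vert 0).obj X) :=
  have := isIso_terminalArrow_unit h
  asIso ((D.ranAdj (slot J (𝒦.vertex (n := 1) 0))).unit.app X)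

/-- The terminal arrows are the arrows with terminal target. -/
lemma essImage_terminalArrow_iff (X : D.on (J.prod (𝒦.ord 1))) :
    (D.terminalArrow J).essImage X ↔ Nonempty (Limits.IsTerminal ((D.vert 1).obj X)) := by
  refine ⟨?_, fun h => ⟨_, ⟨(isoTerminalArrow h).symm⟩⟩⟩
  rintro ⟨Y, ⟨e⟩⟩
  exact ⟨(isTerminal_vert_terminalArrow Y).some.ofIso ((D.vert 1).mapIso e)⟩

/-- Terminal arrows are stable under restriction. -/
noncomputable def pullTerminalArrowIso (u : J ⥤ K) (X : D.on K) :
    (D.pull (prodMap u (𝒦.ord 1))).obj ((D.terminalArrow K).obj X) ≅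
      (D.terminalArrow J).obj ((D.pull u).obj X) :=
  isoTerminalArrow (X := (D.pull (prodMap u (𝒦.ord 1))).obj ((D.terminalArrow K).obj X))
      ⟨(isTerminal_pull u (isTerminal_vert_terminalArrow X)).some.ofIso
        ((D.prodMapSlotIso u (𝒦.vertex (n := 1) 1)).symm.app _)⟩ ≪≫
    (D.terminalArrow J).mapIso ((D.prodMapSlotIso u (𝒦.vertex (n := 1) 0)).app _ ≪≫
      (D.pull u).mapIso (terminalArrowVertIso X))

end

end Prederivator

namespace Prederivator

open DiagramCategory

variable {𝒦 : DiagramCategory.{w}} {D : Prederivator.{w, v, u} 𝒦}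

/-! ### Coherent orthogonality -/

section

variable {J K : 𝒦.Obj}

lemma bijective_precomp_of_isIso {C : Type*} [Category* C] {X Y : C} (f : X ⟶ Y) [IsIso f] (Z : C) :
    Function.Bijective (fun g : Y ⟶ Z => f ≫ g) :=
  ObjectProperty.isLocal_of_isIso (fun _ => True) f Z trivial

lemma isIso_vert_one_pullAdjunction_unit (X : D.on (J.prod (𝒦.ord 1))) :
    IsIso ((D.vert 1).map ((D.pullAdjunction (fstAdjunction J)).unit.app X)) := by
  let a := D.pullAdjunction (fstAdjunction J)
  have : IsIso a.counit := a.isIso_counit_of_iso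
    (D.pullCompIso (u := slot J (𝒦.vertex (n := 1) 1)) (v := fst J (𝒦.ord 1)) (t := 𝟭 J)
      (Iso.refl _) ≪≫ D.pullId J)
  rw [IsIso.eq_inv_of_inv_hom_id (a.left_triangle_components X)]
  infer_instance

variable [IsDerivator D]

/-- As `p_! ≅ 1^*`, the unit `X ⟶ p^* p_! X` is invertible at the target. -/
lemma isIso_vert_one_unit (X : D.on (J.prod (𝒦.ord 1))) :
    IsIso ((D.vert 1).map ((D.lanAdj (fst J (𝒦.ord 1))).unit.app X)) := by
  have := isIso_vert_one_pullAdjunction_unit X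
  rw [← CategoryTheory.Adjunction.unit_leftAdjointUniq_hom_app
    (D.pullAdjunction (fstAdjunction J)), Functor.map_comp]
  infer_instance

/-- On morphisms into an invertible arrow, evaluation at the target is bijective. -/
lemma vert_one_map_bijective (X : D.on (J.prod (𝒦.ord 1))) {Y : D.on (J.prod (𝒦.ord 1))}
    (hY : IsIso (D.dia Y)) : Function.Bijective (fun g : X ⟶ Y => (D.vert 1).map g) := by
  let a := D.pullAdjunction (fstAdjunction J)
  have : IsIso (a.unit.app Y) := isIso_of_isIso_dia _ hY (isIso_dia_pull_fst _)
    (isIso_vert_one_pullAdjunction_unit Y)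
  refine (Function.Bijective.of_comp_iff' (a.homEquiv X _).bijective _).1
    ((Eq.to_iff (congrArg _ (funext fun f => ?_))).1
      ((asIso (a.unit.app Y)).homToEquiv (Z := X)).bijective)
  rw [Function.comp_apply, CategoryTheory.Adjunction.homEquiv_unit]
  exact a.unit.naturality f

/-- On morphisms into a terminal arrow, evaluation at the source is bijective. -/
lemma vert_zero_map_bijective (X : D.on (J.prod (𝒦.ord 1))) {Y : D.on (J.prod (𝒦.ord 1))}
    (hY : Nonempty (Limits.IsTerminal ((D.vert 1).obj Y))) :
    Function.Bijective (fun g : X ⟶ Y => (D.vert 0).map g) :=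
  pull_map_bijective _ (isIso_terminalArrow_unit hY) X

/-- The unit `X ⟶ p^* p_! X` may be replaced by any morphism from `X` to an invertible arrow which
is invertible on targets. -/
lemma orthogonal_iff {X X' Y : D.on (J.prod (𝒦.ord 1))} (f : X ⟶ X') (hX' : IsIso (D.dia X'))
    (hf : IsIso ((D.vert 1).map f)) :
    D.Orthogonal X Y ↔ Function.Bijective (fun g : X' ⟶ Y => f ≫ g) := by
  let a := D.lanAdj (fst J (𝒦.ord 1))
  -- `X'` lies in the image of `p^*`, so `f` factors through the unit by an isomorphism.
  have hη : IsIso (a.unit.app X') :=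
    isIso_of_isIso_dia _ hX' (isIso_dia_pull_fst _) (isIso_vert_one_unit X')
  obtain ⟨g, hg⟩ : ∃ g, a.unit.app X ≫ g = f :=
    ⟨(D.pull _).map ((D.lan _).map f) ≫ inv (a.unit.app X'), by
      rw [← Category.assoc, IsIso.comp_inv_eq]
      exact (a.unit.naturality f).symm⟩
  have := isIso_vert_one_unit X
  have hg₁ : IsIso ((D.vert 1).map g) :=
    IsIso.of_isIso_fac_left (f := (D.vert 1).map (a.unit.app X)) (h := (D.vert 1).map f)
      (by rw [← Functor.map_comp, hg])
  have := isIso_of_isIso_dia g (isIso_dia_pull_fst _) hX' hg₁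
  refine (Function.Bijective.of_comp_iff _ (bijective_precomp_of_isIso g Y)).symm.trans
    (Eq.to_iff (congrArg _ (funext fun k => ?_)))
  rw [Function.comp_apply, ← hg, Category.assoc]

lemma Orthogonal.of_iso_left {X X' Y : D.on (J.prod (𝒦.ord 1))} (e : X ≅ X')
    (h : D.Orthogonal X' Y) : D.Orthogonal X Y := by
  have := isIso_vert_one_unit X'
  refine (orthogonal_iff (e.hom ≫ (D.lanAdj (fst J (𝒦.ord 1))).unit.app X')
    (isIso_dia_pull_fst _) ?_).2 ?_
  · rw [Functor.map_comp]
    infer_instance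
  · have := (bijective_precomp_of_isIso e.hom Y).comp h
    simpa [Function.comp_def] using this

lemma Orthogonal.of_iso_right {X Y Y' : D.on (J.prod (𝒦.ord 1))} (e : Y ≅ Y')
    (h : D.Orthogonal X Y) : D.Orthogonal X Y' := by
  have := (e.homToEquiv (Z := X)).bijective.comp (h.comp (e.symm.homToEquiv).bijective)
  simpa [Function.comp_def, Orthogonal] using this

/-- Invertible arrows are left orthogonal to everything. -/
lemma orthogonal_of_isIso_dia {X : D.on (J.prod (𝒦.ord 1))} (h : IsIso (D.dia X))
    (Y : D.on (J.prod (𝒦.ord 1))) : D.Orthogonal X Y :=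
  (orthogonal_iff (𝟙 X) h inferInstance).2 (bijective_precomp_of_isIso _ _)

/-- Orthogonality to the terminal arrow of `B` means that `Hom(X_1, B) ⟶ Hom(X_0, B)` is
bijective. -/
lemma orthogonal_terminalArrow_iff (X : D.on (J.prod (𝒦.ord 1))) (B : D.on J) :
    D.Orthogonal X ((D.terminalArrow J).obj B) ↔
      Function.Bijective (fun g : (D.vert 1).obj X ⟶ B => D.dia X ≫ g) := by
  let P : ObjectProperty (D.on J) := fun Z => Z = B
  have hP {A A' : D.on J} (f : A ⟶ A') :
      P.isLocal f ↔ Function.Bijective (fun g : A' ⟶ B => f ≫ g) :=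
    ⟨fun h => h B rfl, fun h Z hZ => by cases hZ; exact h⟩
  let X' := (D.pull (fst J (𝒦.ord 1))).obj ((D.lan (fst J (𝒦.ord 1))).obj X)
  let η : X ⟶ X' := (D.lanAdj (fst J (𝒦.ord 1))).unit.app X
  have h₁ : D.Orthogonal X ((D.terminalArrow J).obj B) ↔ P.isLocal ((D.vert 0).map η) := by
    let a := D.ranAdj (slot J (𝒦.vertex (n := 1) 0))
    rw [hP, ← Function.Bijective.of_comp_iff' (a.homEquiv X B).bijective]
    refine (Function.Bijective.of_comp_iff _ (a.homEquiv X' B).bijective).symm.trans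
      (Eq.to_iff (congrArg _ (funext fun k => ?_)))
    exact (a.homEquiv_naturality_left η k).symm
  have := isIso_vert_one_unit X
  have := isIso_dia_pull_fst ((D.lan (fst J (𝒦.ord 1))).obj X)
  rw [h₁, ← hP, ← P.isLocal.cancel_right_of_respectsIso _ (D.dia X'),
    ← P.isLocal.cancel_right_of_respectsIso (D.dia X) ((D.vert 1).map η), dia_naturality]

/-- Orthogonality is compatible with the adjunction between `u_!` and `u^*`. -/
lemma orthogonal_pull_iff (u : J ⥤ K) (X : D.on (J.prod (𝒦.ord 1)))
    (Y : D.on (K.prod (𝒦.ord 1))) :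
    D.Orthogonal X ((D.pull (prodMap u (𝒦.ord 1))).obj Y) ↔
      D.Orthogonal ((D.lan (prodMap u (𝒦.ord 1))).obj X) Y := by
  let a := D.lanAdj (prodMap u (𝒦.ord 1))
  -- The functors `p^* ⋙ (u × [1])_!` and `u_! ⋙ p^*` are left adjoint to isomorphic functors,
  -- because `p^*` is left adjoint to the evaluation at `0`.
  let b₁ := (D.pullAdjunction (slotZeroAdjunction J)).comp a
  let b₂ := (D.lanAdj u).comp (D.pullAdjunction (slotZeroAdjunction K))
  let i : D.pull (fst J (𝒦.ord 1)) ⋙ D.lan (prodMap u (𝒦.ord 1)) ≅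
      D.lan u ⋙ D.pull (fst K (𝒦.ord 1)) :=
    ((conjugateIsoEquiv b₁ b₂).symm (D.prodMapSlotIso u (𝒦.vertex (n := 1) 0))).symm
  -- The same argument for `(u × [1])_! ⋙ 1^*` and `1^* ⋙ u_!`, as `1^*` is left adjoint to `p^*`.
  let c₁ := a.comp (D.pullAdjunction (fstAdjunction K))
  let c₂ := (D.pullAdjunction (fstAdjunction J)).comp (D.lanAdj u)
  let k : D.lan (prodMap u (𝒦.ord 1)) ⋙ D.vert 1 ≅ D.vert 1 ⋙ D.lan u :=
    ((conjugateIsoEquiv c₁ c₂).symm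
      (D.pullCompIso (u := prodMap u (𝒦.ord 1)) (v := fst K (𝒦.ord 1))
        (t := fst J (𝒦.ord 1) ⋙ u) (Iso.refl _) ≪≫ D.pullComp (fst J (𝒦.ord 1)) u)).symm
  let η : X ⟶ (D.pull (fst J (𝒦.ord 1))).obj ((D.lan (fst J (𝒦.ord 1))).obj X) :=
    (D.lanAdj (fst J (𝒦.ord 1))).unit.app X
  have hη := isIso_vert_one_unit X
  rw [orthogonal_iff (Y := Y) ((D.lan (prodMap u (𝒦.ord 1))).map η)
    ((isIso_dia_congr (i.app _)).2 (isIso_dia_pull_fst _))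
    ((NatIso.isIso_map_iff k η).2 (inferInstanceAs (IsIso ((D.lan u).map ((D.vert 1).map η))))),
    ← Function.Bijective.of_comp_iff' (a.homEquiv X Y).bijective]
  refine (Function.Bijective.of_comp_iff _ (a.homEquiv _ Y).bijective).symm.trans
    (Eq.to_iff (congrArg _ (funext fun g => ?_)))
  exact (a.homEquiv_naturality_left η g).symm

end

end Prederivator

namespace CategoryTheory.Pseudofunctor.StrongTrans

/-! ### Left adjoints in the 2-category of pseudofunctors to `Cat` -/

universe w₁ v₁ u₁

variable {B : Type u₁} [Bicategory.{w₁, v₁} B] {E D : Pseudofunctor B Cat.{v, u}} (R : E ⟶ D)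

/-- The isomorphism `R_c (E_f Z) ≅ D_f (R_b Z)` given by the pseudonaturality of `R`. -/
def natIsoApp {b c : B} (f : b ⟶ c) (Z : E.obj b) :
    (R.app c).toFunctor.obj ((E.map f).toFunctor.obj Z) ≅
      (D.map f).toFunctor.obj ((R.app b).toFunctor.obj Z) :=
  (Cat.Hom.toNatIso (R.naturality f)).app Z

variable {b c : B}

lemma natIsoApp_inv_naturality (f : b ⟶ c) {Z Z' : E.obj b} (g : Z ⟶ Z') :
    (D.map f).toFunctor.map ((R.app b).toFunctor.map g) ≫ (R.natIsoApp f Z').inv =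
      (R.natIsoApp f Z).inv ≫ (R.app c).toFunctor.map ((E.map f).toFunctor.map g) :=
  (R.naturality f).inv.toNatTrans.naturality g

lemma natIsoApp_map₂ {f g : b ⟶ c} (α : f ⟶ g) (Z : E.obj b) :
    (R.app c).toFunctor.map ((E.map₂ α).toNatTrans.app Z) ≫ (R.natIsoApp g Z).hom =
      (R.natIsoApp f Z).hom ≫ (D.map₂ α).toNatTrans.app ((R.app b).toFunctor.obj Z) :=
  congrArg (fun γ => γ.toNatTrans.app Z) (R.naturality_naturality α)

lemma natIsoApp_id (Z : E.obj b) :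
    (R.natIsoApp (𝟙 b) Z).hom ≫ (D.mapId b).hom.toNatTrans.app ((R.app b).toFunctor.obj Z) =
      (R.app b).toFunctor.map ((E.mapId b).hom.toNatTrans.app Z) :=
  (congrArg (fun γ => γ.toNatTrans.app Z) (R.naturality_id b)).trans
    ((congrArg (_ ≫ ·) (Category.id_comp _)).trans (Category.comp_id _))

lemma natIsoApp_comp {d : B} (f : b ⟶ c) (g : c ⟶ d) (Z : E.obj b) :
    (R.natIsoApp (f ≫ g) Z).hom ≫
        (D.mapComp f g).hom.toNatTrans.app ((R.app b).toFunctor.obj Z) =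
      (R.app d).toFunctor.map ((E.mapComp f g).hom.toNatTrans.app Z) ≫
        (R.natIsoApp g ((E.map f).toFunctor.obj Z)).hom ≫
          (D.map g).toFunctor.map (R.natIsoApp f Z).hom :=
  (congrArg (fun γ => γ.toNatTrans.app Z) (R.naturality_comp f g)).trans
    (congrArg (_ ≫ ·) ((Category.id_comp _).trans (congrArg (_ ≫ ·)
      ((Category.id_comp _).trans (Category.comp_id _)))))

/-- A morphism `η : X ⟶ R_b Z` is universal if it exhibits `Z` as a reflection of `X` along
`R_b`. -/
def IsUniversal {X : D.obj b} {Z : E.obj b} (η : X ⟶ (R.app b).toFunctor.obj Z) : Prop :=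
  ∀ Y : E.obj b, Function.Bijective (fun g : Z ⟶ Y => η ≫ (R.app b).toFunctor.map g)

variable {R}

lemma IsUniversal.hom_ext {X : D.obj b} {Z : E.obj b} {η : X ⟶ (R.app b).toFunctor.obj Z}
    (h : R.IsUniversal η) {Y : E.obj b} {g g' : Z ⟶ Y}
    (e : η ≫ (R.app b).toFunctor.map g = η ≫ (R.app b).toFunctor.map g') : g = g' :=
  (h Y).1 e

lemma IsUniversal.isIso {X : D.obj b} {Z Z' : E.obj b} {η : X ⟶ (R.app b).toFunctor.obj Z}
    {η' : X ⟶ (R.app b).toFunctor.obj Z'} (h : R.IsUniversal η) (h' : R.IsUniversal η')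
    {g : Z ⟶ Z'} (e : η ≫ (R.app b).toFunctor.map g = η') : IsIso g := by
  obtain ⟨k, hk⟩ := (h' Z).2 η
  dsimp only at hk
  refine ⟨k, h.hom_ext ?_, h'.hom_ext ?_⟩
  · rw [Functor.map_comp, ← Category.assoc, e, hk, Functor.map_id, Category.comp_id]
  · rw [Functor.map_comp, ← Category.assoc, hk, e, Functor.map_id, Category.comp_id]

variable (R)

/-- The image under `D_f` of a morphism `X ⟶ R_b Z`, regarded as a morphism
`D_f X ⟶ R_c (E_f Z)`. -/
def transport (f : b ⟶ c) {X : D.obj b} {Z : E.obj b} (η : X ⟶ (R.app b).toFunctor.obj Z) :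
    (D.map f).toFunctor.obj X ⟶ (R.app c).toFunctor.obj ((E.map f).toFunctor.obj Z) :=
  (D.map f).toFunctor.map η ≫ (R.natIsoApp f Z).inv

section

variable {R} {L : ∀ b : B, D.obj b ⥤ E.obj b} (adj : ∀ b, L b ⊣ (R.app b).toFunctor)

lemma isUniversal_unit (X : D.obj b) : R.IsUniversal ((adj b).unit.app X) := fun Y => by
  have e : (fun g => (adj b).unit.app X ≫ (R.app b).toFunctor.map g) = (adj b).homEquiv X Y :=
    funext fun _ => (CategoryTheory.Adjunction.homEquiv_unit _ _ _ _).symm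
  exact e ▸ ((adj b).homEquiv X Y).bijective

lemma adj_hom_ext {X : D.obj b} {Y : E.obj b} {g g' : (L b).obj X ⟶ Y}
    (e : (adj b).unit.app X ≫ (R.app b).toFunctor.map g =
      (adj b).unit.app X ≫ (R.app b).toFunctor.map g') : g = g' :=
  (isUniversal_unit adj X).hom_ext e

/-- The mate `L_c (D_f X) ⟶ E_f (L_b X)`. -/
def mateApp (f : b ⟶ c) (X : D.obj b) :
    (L c).obj ((D.map f).toFunctor.obj X) ⟶ (E.map f).toFunctor.obj ((L b).obj X) :=
  ((adj c).homEquiv _ _).symm (R.transport f ((adj b).unit.app X))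

lemma unit_mateApp (f : b ⟶ c) (X : D.obj b) :
    (adj c).unit.app ((D.map f).toFunctor.obj X) ≫ (R.app c).toFunctor.map (mateApp adj f X) =
      (D.map f).toFunctor.map ((adj b).unit.app X) ≫ (R.natIsoApp f ((L b).obj X)).inv := by
  have := ((adj c).homEquiv _ _).apply_symm_apply (R.transport f ((adj b).unit.app X))
  rwa [CategoryTheory.Adjunction.homEquiv_unit] at this

lemma unit_mateApp_assoc (f : b ⟶ c) (X : D.obj b) {Y : D.obj c}
    (k : (R.app c).toFunctor.obj ((E.map f).toFunctor.obj ((L b).obj X)) ⟶ Y) :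
    (adj c).unit.app ((D.map f).toFunctor.obj X) ≫
        (R.app c).toFunctor.map (mateApp adj f X) ≫ k =
      (D.map f).toFunctor.map ((adj b).unit.app X) ≫
        (R.natIsoApp f ((L b).obj X)).inv ≫ k := by
  rw [← Category.assoc, unit_mateApp, Category.assoc]

lemma adj_unit_naturality {X X' : D.obj b} (g : X ⟶ X') :
    (adj b).unit.app X ≫ (R.app b).toFunctor.map ((L b).map g) = g ≫ (adj b).unit.app X' :=
  ((adj b).unit.naturality g).symm

lemma mateApp_naturality (f : b ⟶ c) {X X' : D.obj b} (g : X ⟶ X') :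
    (L c).map ((D.map f).toFunctor.map g) ≫ mateApp adj f X' =
      mateApp adj f X ≫ (E.map f).toFunctor.map ((L b).map g) := by
  refine adj_hom_ext adj ?_
  rw [Functor.map_comp, Functor.map_comp, unit_mateApp_assoc, ← Category.assoc,
    adj_unit_naturality, Category.assoc, unit_mateApp, ← natIsoApp_inv_naturality,
    ← Category.assoc, ← Category.assoc, ← Functor.map_comp, ← Functor.map_comp,
    adj_unit_naturality]

lemma mateApp_map₂ {f g : b ⟶ c} (α : f ⟶ g) (X : D.obj b) :
    (L c).map ((D.map₂ α).toNatTrans.app X) ≫ mateApp adj g X =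
      mateApp adj f X ≫ (E.map₂ α).toNatTrans.app ((L b).obj X) := by
  refine adj_hom_ext adj ?_
  have h : (D.map₂ α).toNatTrans.app ((R.app b).toFunctor.obj ((L b).obj X)) ≫
      (R.natIsoApp g ((L b).obj X)).inv = (R.natIsoApp f ((L b).obj X)).inv ≫
        (R.app c).toFunctor.map ((E.map₂ α).toNatTrans.app ((L b).obj X)) := by
    rw [Iso.eq_inv_comp, ← Category.assoc, Iso.comp_inv_eq, natIsoApp_map₂]
  have h' : (D.map₂ α).toNatTrans.app X ≫ (D.map g).toFunctor.map ((adj b).unit.app X) =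
      (D.map f).toFunctor.map ((adj b).unit.app X) ≫
        (D.map₂ α).toNatTrans.app ((R.app b).toFunctor.obj ((L b).obj X)) :=
    ((D.map₂ α).toNatTrans.naturality ((adj b).unit.app X)).symm
  rw [Functor.map_comp, Functor.map_comp, unit_mateApp_assoc, ← Category.assoc,
    adj_unit_naturality, Category.assoc, unit_mateApp, ← h, ← Category.assoc, h', Category.assoc]

lemma mateApp_id (X : D.obj b) :
    mateApp adj (𝟙 b) X ≫ (E.mapId b).hom.toNatTrans.app ((L b).obj X) =
      (L b).map ((D.mapId b).hom.toNatTrans.app X) := by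
  refine adj_hom_ext adj ?_
  have h' : (D.map (𝟙 b)).toFunctor.map ((adj b).unit.app X) ≫
      (D.mapId b).hom.toNatTrans.app ((R.app b).toFunctor.obj ((L b).obj X)) =
      (D.mapId b).hom.toNatTrans.app X ≫ (adj b).unit.app X :=
    (D.mapId b).hom.toNatTrans.naturality ((adj b).unit.app X)
  rw [Functor.map_comp, unit_mateApp_assoc, ← natIsoApp_id, Iso.inv_hom_id_assoc, h']
  exact (adj_unit_naturality adj _).symm

lemma mateApp_comp {d : B} (f : b ⟶ c) (g : c ⟶ d) (X : D.obj b) :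
    mateApp adj (f ≫ g) X ≫ (E.mapComp f g).hom.toNatTrans.app ((L b).obj X) =
      (L d).map ((D.mapComp f g).hom.toNatTrans.app X) ≫
        mateApp adj g ((D.map f).toFunctor.obj X) ≫
          (E.map g).toFunctor.map (mateApp adj f X) := by
  refine adj_hom_ext adj ?_
  have h' : (D.map (f ≫ g)).toFunctor.map ((adj b).unit.app X) ≫
      (D.mapComp f g).hom.toNatTrans.app ((R.app b).toFunctor.obj ((L b).obj X)) =
      (D.mapComp f g).hom.toNatTrans.app X ≫
        (D.map g).toFunctor.map ((D.map f).toFunctor.map ((adj b).unit.app X)) :=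
    (D.mapComp f g).hom.toNatTrans.naturality ((adj b).unit.app X)
  have h : (D.mapComp f g).hom.toNatTrans.app ((R.app b).toFunctor.obj ((L b).obj X)) ≫
      (D.map g).toFunctor.map (R.natIsoApp f ((L b).obj X)).inv ≫
        (R.natIsoApp g ((E.map f).toFunctor.obj ((L b).obj X))).inv =
      (R.natIsoApp (f ≫ g) ((L b).obj X)).inv ≫
        (R.app d).toFunctor.map ((E.mapComp f g).hom.toNatTrans.app ((L b).obj X)) := by
    rw [Iso.eq_inv_comp, ← Category.assoc, natIsoApp_comp]
    simp only [Category.assoc, ← Functor.map_comp_assoc, Iso.hom_inv_id, Functor.map_id,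
      Category.id_comp, Category.comp_id]
  have hr : (adj d).unit.app ((D.map (f ≫ g)).toFunctor.obj X) ≫ (R.app d).toFunctor.map
      ((L d).map ((D.mapComp f g).hom.toNatTrans.app X)) =
      (D.mapComp f g).hom.toNatTrans.app X ≫
        (adj d).unit.app ((D.map g).toFunctor.obj ((D.map f).toFunctor.obj X)) :=
    adj_unit_naturality adj _
  rw [Functor.map_comp, unit_mateApp_assoc, ← h, ← Category.assoc, h', Functor.map_comp,
    Functor.map_comp, ← Category.assoc ((adj d).unit.app _), hr, Category.assoc]
  refine Eq.trans (congrArg (_ ≫ ·) ?_) (Category.assoc _ _ _).symm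
  rw [unit_mateApp_assoc, ← natIsoApp_inv_naturality, ← Category.assoc, ← Category.assoc,
    ← Functor.map_comp, ← Functor.map_comp, unit_mateApp]

lemma mateApp_counit (f : b ⟶ c) (Y : E.obj b) :
    ((L c).map (R.natIsoApp f Y).hom ≫ mateApp adj f ((R.app b).toFunctor.obj Y)) ≫
        (E.map f).toFunctor.map ((adj b).counit.app Y) =
      (adj c).counit.app ((E.map f).toFunctor.obj Y) := by
  refine adj_hom_ext adj ?_
  have h := (adj b).right_triangle_components Y
  rw [(adj c).right_triangle_components, Functor.map_comp, Functor.map_comp, Category.assoc,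
    ← Category.assoc, adj_unit_naturality, Category.assoc, unit_mateApp_assoc,
    ← natIsoApp_inv_naturality, ← Category.assoc ((D.map f).toFunctor.map _), ← Functor.map_comp, h]
  exact (congrArg (_ ≫ ·) ((congrArg (· ≫ _) (Functor.map_id _ _)).trans
    (Category.id_comp _))).trans (Iso.hom_inv_id _)

variable (hR : ∀ {b c : B} (f : b ⟶ c) (X : D.obj b),
  R.IsUniversal (R.transport f ((adj b).unit.app X)))

/-- Left adjoints at all objects assemble to a strong transformation if restrictions of universal
morphisms are universal. -/
noncomputable def leftAdjoint : D ⟶ E where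
  app b := Functor.toCatHom (D := E.obj b) (L b)
  naturality {b c} f := Cat.Hom.isoMk (C := D.obj b) (D := E.obj c)
    (F := (D.map f).toFunctor ⋙ L c) (G := L b ⋙ (E.map f).toFunctor)
    (NatIso.ofComponents (fun X =>
        have := (isUniversal_unit adj _).isIso (hR f X) (unit_mateApp adj f X)
        asIso (mateApp adj f X))
      (fun g => mateApp_naturality adj f g))
  naturality_naturality α := Cat.Hom₂.ext (NatTrans.ext (funext fun X => mateApp_map₂ adj α X))
  naturality_id _ := Cat.Hom₂.ext (NatTrans.ext (funext fun X =>
    (mateApp_id adj X).trans ((congrArg (_ ≫ ·) (Category.id_comp (𝟙 _))).trans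
      (Category.comp_id _)).symm))
  naturality_comp f g := Cat.Hom₂.ext (NatTrans.ext (funext fun X =>
    (mateApp_comp adj f g X).trans (congrArg (_ ≫ ·) ((Category.id_comp _).trans
      (congrArg (_ ≫ ·) ((Category.id_comp _).trans (Category.comp_id _)))).symm)))

/-- The left adjoint just constructed, as an adjunction in the bicategory of pseudofunctors. -/
noncomputable def leftAdjointAdjunction :
    Bicategory.Adjunction (leftAdjoint adj hR) R where
  unit := ⟨{
    app b := Cat.Hom₂.ofNatTrans (adj b).unit
    naturality {b c} f := Cat.Hom₂.ext (NatTrans.ext (funext fun X => by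
      have e : ((leftAdjoint adj hR ≫ R).naturality f).hom.toNatTrans.app X =
          (R.app c).toFunctor.map (mateApp adj f X) ≫ (R.natIsoApp f ((L b).obj X)).hom :=
        (Category.id_comp _).trans (congrArg (_ ≫ ·) ((Category.id_comp _).trans
          (Category.comp_id _)))
      have e' : ((𝟙 D : D ⟶ D).naturality f).hom.toNatTrans.app X =
          𝟙 ((D.map f).toFunctor.obj X) := Category.id_comp _
      refine (congrArg ((adj c).unit.app ((D.map f).toFunctor.obj X) ≫ ·) e).trans ?_
      refine Eq.trans ?_ (congrArg (· ≫ (D.map f).toFunctor.map ((adj b).unit.app X)) e').symm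
      refine (unit_mateApp_assoc adj f X _).trans ?_
      exact (congrArg (_ ≫ ·) (Iso.inv_hom_id _)).trans
        ((Category.comp_id _).trans (Category.id_comp _).symm))) }⟩
  counit := ⟨{
    app b := Cat.Hom₂.ofNatTrans (adj b).counit
    naturality {b c} f := Cat.Hom₂.ext (NatTrans.ext (funext fun Y => by
      have e : ((R ≫ leftAdjoint adj hR).naturality f).hom.toNatTrans.app Y =
          (L c).map (R.natIsoApp f Y).hom ≫ mateApp adj f ((R.app b).toFunctor.obj Y) :=
        (Category.id_comp _).trans (congrArg (_ ≫ ·) ((Category.id_comp _).trans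
          (Category.comp_id _)))
      have e' : ((𝟙 E : E ⟶ E).naturality f).hom.toNatTrans.app Y =
          𝟙 ((E.map f).toFunctor.obj Y) := Category.id_comp _
      refine (congrArg ((adj c).counit.app ((E.map f).toFunctor.obj Y) ≫ ·) e').trans ?_
      refine Eq.trans ?_ (congrArg (· ≫ (E.map f).toFunctor.map ((adj b).counit.app Y)) e).symm
      exact (Category.comp_id _).trans (mateApp_counit adj f Y).symm)) }⟩
  left_triangle := by
    rw [leftZigzag_eq]
    refine homCategory.ext fun b => Cat.Hom₂.ext (NatTrans.ext (funext fun X => ?_))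
    refine (congrArg ((L b).map ((adj b).unit.app X) ≫ ·) (Category.id_comp _)).trans ?_
    exact ((adj b).left_triangle_components X).trans (Category.comp_id (𝟙 _)).symm
  right_triangle := by
    rw [rightZigzag_eq]
    refine homCategory.ext fun b => Cat.Hom₂.ext (NatTrans.ext (funext fun Y => ?_))
    refine (congrArg ((adj b).unit.app ((R.app b).toFunctor.obj Y) ≫ ·)
      (Category.id_comp _)).trans ?_
    exact ((adj b).right_triangle_components Y).trans (Category.comp_id (𝟙 _)).symm

end

/-- A strong transformation has a left adjoint if every object admits a universal morphism all of
whose restrictions are universal. -/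
theorem exists_leftAdjoint
    (h : ∀ (b : B) (X : D.obj b), ∃ (Z : E.obj b) (η : X ⟶ (R.app b).toFunctor.obj Z),
      R.IsUniversal η ∧ ∀ (c : B) (f : b ⟶ c), R.IsUniversal (R.transport f η)) :
    ∃ L : D ⟶ E, Nonempty (Bicategory.Adjunction L R) := by
  choose Z η h₁ h₂ using h
  let adj (b : B) := CategoryTheory.Adjunction.adjunctionOfEquivLeft (G := (R.app b).toFunctor)
    (fun X Y => Equiv.ofBijective _ (h₁ b X Y))
    (fun X Y Y' g k => by
      simp only [Equiv.ofBijective_apply, Functor.map_comp, Category.assoc])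
  have e (b : B) (X : D.obj b) : (adj b).unit.app X = η b X := by
    have e' : (adj b).unit.app X = η b X ≫ (R.app b).toFunctor.map (𝟙 (Z b X)) := by
      simp [adj, CategoryTheory.Adjunction.adjunctionOfEquivLeft]
    rw [e', Functor.map_id, Category.comp_id]
  exact ⟨_, ⟨leftAdjointAdjunction adj (fun {b c} f X => by rw [e]; exact h₂ b X c f)⟩⟩

variable {R} in
/-- The adjunction at the object `b` underlying an adjunction of pseudofunctors. -/
def adjunctionAt {L : D ⟶ E} (adj : Bicategory.Adjunction L R) (b : B) :
    (L.app b).toFunctor ⊣ (R.app b).toFunctor where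
  unit := (adj.unit.as.app b).toNatTrans
  counit := (adj.counit.as.app b).toNatTrans
  left_triangle_components X := by
    have h := congrArg (fun γ => (γ.as.app b).toNatTrans.app X)
      ((leftZigzag_eq _ _).symm.trans adj.left_triangle)
    refine (congrArg (_ ≫ ·) (Category.id_comp _).symm).trans (h.trans (Category.comp_id _))
  right_triangle_components Y := by
    have h := congrArg (fun γ => (γ.as.app b).toNatTrans.app Y)
      ((rightZigzag_eq _ _).symm.trans adj.right_triangle)
    refine (congrArg (_ ≫ ·) (Category.id_comp _).symm).trans (h.trans (Category.comp_id _))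

end CategoryTheory.Pseudofunctor.StrongTrans

namespace SubPrederivator

open DiagramCategory Prederivator

variable {𝒦 : DiagramCategory.{w}} {D : Prederivator.{w, v, u} 𝒦} (S : SubPrederivator D)

/-! ### Choric classes of local objects -/

/-- The coherent arrows `X` such that `X_0 ⟶ X_1` is inverted by `Hom(-, B)` for all `B` in `S`. -/
def acyclic (J : 𝒦.Obj) : ObjectProperty (D.on (J.prod (𝒦.ord 1))) :=
  fun X => (S.mem J).isLocal (D.dia X)

/-- The coherent arrows which exhibit their target as the reflection of their source into `S`. -/
def IsReflectionArrow {J : 𝒦.Obj} (X : D.on (J.prod (𝒦.ord 1))) : Prop :=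
  S.acyclic J X ∧ S.mem J ((D.vert 1).obj X)

/-- A class of objects which is the class of local objects of a choric reflection: each object is
the source of a coherent reflection arrow, reflection arrows are universal among coherent arrows
with target in `S`, and acyclic arrows are stable under restriction. -/
structure IsChoricClass : Prop where
  isClosedUnderIsomorphisms : ∀ J : 𝒦.Obj, (S.mem J).IsClosedUnderIsomorphisms
  pull_acyclic : ∀ {J K : 𝒦.Obj} (u : J ⥤ K) (X : D.on (K.prod (𝒦.ord 1))),
    S.acyclic K X → S.acyclic J ((D.pull (prodMap u (𝒦.ord 1))).obj X)
  exists_isReflectionArrow : ∀ (J : 𝒦.Obj) (X : D.on J),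
    ∃ C : D.on (J.prod (𝒦.ord 1)), S.IsReflectionArrow C ∧ Nonempty ((D.vert 0).obj C ≅ X)
  bijective : ∀ {J : 𝒦.Obj} (C Y : D.on (J.prod (𝒦.ord 1))), S.IsReflectionArrow C →
    S.mem J ((D.vert 1).obj Y) → Function.Bijective (fun f : C ⟶ Y => (D.vert 0).map f)

section

variable {S} {J K : 𝒦.Obj}

lemma acyclic_of_iso {X Y : D.on (J.prod (𝒦.ord 1))} (e : X ≅ Y) (h : S.acyclic J X) :
    S.acyclic J Y :=
  ((S.mem J).isLocal.arrow_mk_iso_iff ((D.diaFunctor J).mapIso e)).1 h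

lemma acyclic_pull_iff (u : J ⥤ K) (X : D.on (K.prod (𝒦.ord 1))) :
    S.acyclic J ((D.pull (prodMap u (𝒦.ord 1))).obj X) ↔
      (S.mem J).isLocal ((D.pull u).map (D.dia X)) :=
  (S.mem J).isLocal.arrow_mk_iso_iff (D.prodMapDiaIso u X)

lemma acyclic_edge_iff {n : ℕ} {i j : Fin (n + 1)} (h : i ≤ j) (X : D.on (J.prod (𝒦.ord n))) :
    S.acyclic J ((D.edge h).obj X) ↔
      (S.mem J).isLocal ((D.pull₂ (slotMap J (𝒦.edge h))).app X) :=
  (S.mem J).isLocal.arrow_mk_iso_iff (D.edgeDiaIso h X)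

namespace IsChoricClass

lemma isReflectionArrow_pull (hS : S.IsChoricClass) (u : J ⥤ K) {C : D.on (K.prod (𝒦.ord 1))}
    (hC : S.IsReflectionArrow C) :
    S.IsReflectionArrow ((D.pull (prodMap u (𝒦.ord 1))).obj C) :=
  have := hS.isClosedUnderIsomorphisms J
  ⟨hS.pull_acyclic u C hC.1, (S.mem J).prop_of_iso
    ((D.prodMapSlotIso u (𝒦.vertex (n := 1) 1)).symm.app C) (S.pull_mem u _ hC.2)⟩

/-- The inclusion of a choric class has a left adjoint. -/
lemma exists_reflector (hS : S.IsChoricClass) :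
    ∃ L : D ⟶ S.toPrederivator, Nonempty (Bicategory.Adjunction L S.incl) := by
  refine Pseudofunctor.StrongTrans.exists_leftAdjoint S.incl fun b X => ?_
  obtain ⟨C, hC, ⟨i⟩⟩ := hS.exists_isReflectionArrow b.unop X
  have key {c : 𝒦.Objᵒᵖ} {A : D.obj c} {Z : S.toPrederivator.obj c} (f : A ⟶ Z.obj)
      (hf : (S.mem c.unop).isLocal f) : S.incl.IsUniversal (b := c) (Z := Z) f := fun Y =>
    (hf Y.obj Y.property).comp
      (ObjectProperty.fullyFaithfulι (S.mem c.unop)).homEquiv.bijective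
  have h : (S.mem b.unop).isLocal (i.inv ≫ D.dia C) :=
    (S.mem b.unop).isLocal.comp_mem _ _ (ObjectProperty.isLocal_of_isIso _ _) hC.1
  refine ⟨⟨(D.vert 1).obj C, hC.2⟩, i.inv ≫ D.dia C, key _ h, fun c f => ?_⟩
  have e : S.incl.transport f (Z := ⟨(D.vert 1).obj C, hC.2⟩) (i.inv ≫ D.dia C) =
      (D.pull f.unop).map i.inv ≫ (D.pull f.unop).map (D.dia C) :=
    (Category.comp_id _).trans (Functor.map_comp _ _ _)
  rw [e]
  exact key _ ((S.mem c.unop).isLocal.comp_mem _ _ (ObjectProperty.isLocal_of_isIso _ _)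
    ((acyclic_pull_iff _ _).1 (hS.pull_acyclic f.unop C hC.1)))

/-- A choric class is the essential image of the right adjoint of a choric reflection. -/
theorem exists_choricReflection (hS : S.IsChoricClass) :
    ∃ r : ChoricReflection D, ∀ J : 𝒦.Obj, (r.1.right J).essImage = S.mem J := by
  obtain ⟨L, ⟨adj⟩⟩ := hS.exists_reflector
  let r : Reflection D :=
    { E := S.toPrederivator
      L := L
      R := S.incl
      adj := adj
      full J := inferInstanceAs ((S.mem J).ι.Full)
      faithful J := inferInstanceAs ((S.mem J).ι.Faithful) }
  have hr (J : 𝒦.Obj) : (r.right J).essImage = S.mem J := by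
    have := hS.isClosedUnderIsomorphisms J
    ext X
    refine ⟨?_, fun h => ⟨⟨X, h⟩, ⟨Iso.refl _⟩⟩⟩
    rintro ⟨Y, ⟨e⟩⟩
    exact (S.mem J).prop_of_iso e Y.property
  have hmem {J : 𝒦.Obj} (X : D.on (J.prod (𝒦.ord 1))) :
      r.chr.mem J X ↔ S.mem J ((D.vert 1).obj X) := by
    rw [← hr]
    rfl
  refine ⟨⟨r, ?_⟩, hr⟩
  have key {c : 𝒦.Objᵒᵖ} {A : D.obj c} {C : D.on (c.unop.prod (𝒦.ord 1))}
      (hC : S.IsReflectionArrow C) (f : A ⟶ (D.vert 0).obj C) (hf : IsIso f) :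
      r.sharp.IsUniversal (b := c) (Z := ⟨C, (hmem C).2 hC.2⟩) f := fun Y =>
    (bijective_precomp_of_isIso f _).comp ((hS.bijective C Y.obj hC ((hmem _).1 Y.property)).comp
      (ObjectProperty.fullyFaithfulι (r.chr.mem c.unop)).homEquiv.bijective)
  obtain ⟨L', ⟨adj'⟩⟩ := Pseudofunctor.StrongTrans.exists_leftAdjoint r.sharp fun b X => by
    obtain ⟨C, hC, ⟨i⟩⟩ := hS.exists_isReflectionArrow b.unop X
    refine ⟨⟨C, (hmem C).2 hC.2⟩, i.inv, key hC _ inferInstance, fun c f => ?_⟩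
    refine key (hS.isReflectionArrow_pull f.unop hC) _ ?_
    exact IsIso.comp_isIso' (inferInstanceAs (IsIso ((D.pull f.unop).map i.inv)))
      (Iso.isIso_inv _)
  exact Bicategory.IsRightAdjoint.mk adj'

end IsChoricClass

variable [IsDerivator D]

/-- Acyclicity is orthogonality to the terminal arrows of the objects of `S`. -/
lemma acyclic_iff_orthogonal (X : D.on (J.prod (𝒦.ord 1))) :
    S.acyclic J X ↔ ∀ B, S.mem J B → D.Orthogonal X ((D.terminalArrow J).obj B) :=
  forall₂_congr fun B _ => (orthogonal_terminalArrow_iff X B).symm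

/-- A morphism of reflection arrows is invertible if it is so on sources. -/
lemma IsReflectionArrow.isIso {C C' : D.on (J.prod (𝒦.ord 1))} (hC : S.IsReflectionArrow C)
    (hC' : S.IsReflectionArrow C') (f : C ⟶ C') (hf : IsIso ((D.vert 0).map f)) : IsIso f := by
  have h₁ : (S.mem J).isLocal ((D.vert 1).map f) :=
    (S.mem J).isLocal.of_precomp (D.dia C) _ hC.1 (by
      rw [← dia_naturality]
      exact (S.mem J).isLocal.comp_mem _ _ (ObjectProperty.isLocal_of_isIso _ _) hC'.1)
  refine isIso_of_vert f fun i => ?_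
  match i with
  | 0 => exact hf
  | 1 => exact (ObjectProperty.isLocal_iff_isIso _ _ hC.2 hC'.2).1 h₁

end

end SubPrederivator

namespace Prederivator

open DiagramCategory

variable {𝒦 : DiagramCategory.{w}} {D : Prederivator.{w, v, u} 𝒦}

/-! ### The choric class of a choric reflection -/

/-- The morphisms which are local with respect to a reflective subcategory are those inverted by
the reflector. -/
lemma isLocal_essImage_iff {C E : Type*} [Category* C] [Category* E] {L : C ⥤ E} {R : E ⥤ C}
    (adj : L ⊣ R) [R.Full] [R.Faithful] {X Y : C} (f : X ⟶ Y) :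
    (ObjectProperty.isLocal R.essImage) f ↔ IsIso (L.map f) := by
  have h : R.essImage = ObjectProperty.isoClosure (· ∈ Set.range R.obj) := by
    ext Z
    constructor
    · rintro ⟨W, ⟨e⟩⟩
      exact ⟨_, ⟨W, rfl⟩, ⟨e.symm⟩⟩
    · rintro ⟨_, ⟨W, rfl⟩, ⟨e⟩⟩
      exact ⟨W, ⟨e.symm⟩⟩
  rw [h, ObjectProperty.isoClosure_isLocal, ObjectProperty.isLocal_iff_isIso_map adj]

namespace Reflection

variable (r : Reflection D)

instance (J : 𝒦.Obj) : (r.right J).Full := r.full J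

instance (J : 𝒦.Obj) : (r.right J).Faithful := r.faithful J

/-- The adjunction `L_J ⊣ R_J`. -/
def adjAt (J : 𝒦.Obj) : r.left J ⊣ r.right J :=
  Pseudofunctor.StrongTrans.adjunctionAt r.adj (op J)

/-- The sub-prederivator of local objects of a reflection. -/
def localObjects : SubPrederivator D where
  mem J := (r.right J).essImage
  pull_mem {J K} u X := by
    rintro ⟨Z, ⟨e⟩⟩
    exact ⟨(r.E.pull u).obj Z, ⟨(Cat.Hom.toNatIso (r.R.naturality (op₁ u))).app Z ≪≫
      (D.pull u).mapIso e⟩⟩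

/-- The reflector commutes with the formation of underlying arrows. -/
def diaLeftIso {J : 𝒦.Obj} (X : D.on (J.prod (𝒦.ord 1))) :
    (r.left J).mapArrow.obj (Arrow.mk (D.dia X)) ≅
      Arrow.mk (r.E.dia ((r.left (J.prod (𝒦.ord 1))).obj X)) :=
  Arrow.isoMk (r.L.natIsoApp (op₁ (slot J (𝒦.vertex (n := 1) 0))) X)
    (r.L.natIsoApp (op₁ (slot J (𝒦.vertex (n := 1) 1))) X)
    (r.L.natIsoApp_map₂
      (op₂ (slotMap J (𝒦.edge (n := 1) (i := 0) (j := 1) (Fin.zero_le _)))) X).symm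

lemma isLocal_iff {J : 𝒦.Obj} {X Y : D.on J} (f : X ⟶ Y) :
    (r.localObjects.mem J).isLocal f ↔ IsIso ((r.left J).map f) :=
  isLocal_essImage_iff (r.adjAt J) f

/-- The acyclic arrows of a reflection are those inverted by the reflector. -/
lemma acyclic_iff_inverted {J : 𝒦.Obj} (X : D.on (J.prod (𝒦.ord 1))) :
    r.localObjects.acyclic J X ↔ r.inverted J X :=
  (r.isLocal_iff _).trans ((MorphismProperty.isomorphisms _).arrow_mk_iso_iff (r.diaLeftIso X))

lemma pull_acyclic {J K : 𝒦.Obj} (u : J ⥤ K) (X : D.on (K.prod (𝒦.ord 1)))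
    (h : r.localObjects.acyclic K X) :
    r.localObjects.acyclic J ((D.pull (prodMap u (𝒦.ord 1))).obj X) := by
  rw [SubPrederivator.acyclic_pull_iff, isLocal_iff]
  have := (r.isLocal_iff _).1 h
  exact (NatIso.isIso_map_iff (Cat.Hom.toNatIso (r.L.naturality (op₁ u))) (D.dia X)).2
    (inferInstanceAs (IsIso ((r.E.pull u).map ((r.left K).map (D.dia X)))))

/-- Terminal objects are local. -/
lemma localObjects_mem_of_isTerminal {J : 𝒦.Obj} {X : D.on J}
    (h : Nonempty (Limits.IsTerminal X)) : r.localObjects.mem J X := by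
  let a := r.adjAt J
  obtain ⟨t⟩ := h
  have : Reflective (r.right J) := { L := r.left J, adj := a }
  have : IsSplitMono ((reflectorAdjunction (r.right J)).unit.app X) :=
    ⟨⟨⟨t.from _, t.hom_ext _ _⟩⟩⟩
  exact mem_essImage_of_unit_isSplitMono

variable [IsDerivator D]

/-- The left adjoint of `R^♯` sends `X` to a reflection arrow `C` with `C_0 ≅ X`, and this arrow is
universal by construction. -/
lemma exists_isReflectionArrow (hr : r.IsChoric) (J : 𝒦.Obj) (X : D.on J) :
    ∃ (C : D.on (J.prod (𝒦.ord 1))), r.localObjects.IsReflectionArrow C ∧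
      Nonempty ((D.vert 0).obj C ≅ X) ∧ ∀ Y, r.chr.mem J Y →
        Function.Bijective (fun f : C ⟶ Y => (D.vert 0).map f) := by
  obtain ⟨⟨L', adj'⟩⟩ := hr
  let a := Pseudofunctor.StrongTrans.adjunctionAt adj' (op J)
  let Z : (r.chr.mem J).FullSubcategory := (L'.app (op J)).toFunctor.obj X
  let C : D.on (J.prod (𝒦.ord 1)) := Z.obj
  let η : X ⟶ (D.vert 0).obj C := a.unit.app X
  -- The universal property of `C`, which reads `Hom(C, Y) ≅ Hom(X, Y_0)`.
  have key (Y : D.on (J.prod (𝒦.ord 1))) (hY : r.chr.mem J Y) :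
      Function.Bijective (fun f : C ⟶ Y => η ≫ (D.vert 0).map f) := by
    have h₁ := Pseudofunctor.StrongTrans.isUniversal_unit (R := r.sharp)
      (L := fun b => (L'.app b).toFunctor)
      (fun b => Pseudofunctor.StrongTrans.adjunctionAt adj' b) (b := op J) X ⟨Y, hY⟩
    exact h₁.comp ((ObjectProperty.fullyFaithfulι (r.chr.mem J)).homEquiv (X := Z)
      (Y := ⟨Y, hY⟩)).symm.bijective
  have hη : IsIso η := by
    refine (ObjectProperty.isLocal_iff_isIso (fun _ => True) η trivial trivial).1 fun A _ => ?_
    have hA := isTerminal_vert_terminalArrow A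
    have h₂ : Function.Bijective (fun g : (D.vert 0).obj C ⟶
        (D.vert 0).obj ((D.terminalArrow J).obj A) => η ≫ g) :=
      (Function.Bijective.of_comp_iff _ (vert_zero_map_bijective C hA)).1
        (key _ (r.localObjects_mem_of_isTerminal hA))
    have e := terminalArrowVertIso A
    have := (e.homToEquiv (Z := X)).bijective.comp
      (h₂.comp (e.symm.homToEquiv (Z := (D.vert 0).obj C)).bijective)
    simpa [Function.comp_def] using this
  have key' (Y : D.on (J.prod (𝒦.ord 1))) (hY : r.chr.mem J Y) :
      Function.Bijective (fun f : C ⟶ Y => (D.vert 0).map f) :=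
    (Function.Bijective.of_comp_iff' (bijective_precomp_of_isIso η _) _).1 (key Y hY)
  refine ⟨C, ⟨fun B hB => ?_, Z.property⟩, ⟨(asIso η).symm⟩, key'⟩
  -- The constant arrow on `B` belongs to `Chr_L`.
  let P := (D.pull (fst J (𝒦.ord 1))).obj B
  have e : (D.vert 1).obj P ≅ B := (D.pullCompIso (u := slot J (𝒦.vertex (n := 1) 1))
    (v := fst J (𝒦.ord 1)) (t := 𝟭 J) (Iso.refl _) ≪≫ D.pullId J).app B
  have hP := isIso_dia_pull_fst B
  have hP' : r.chr.mem J P := (r.right J).essImage.prop_of_iso e.symm hB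
  have h₁ : Function.Bijective (fun f : C ⟶ P => (D.vert 0).map f ≫ D.dia P) :=
    ((asIso (D.dia P)).homToEquiv (Z := (D.vert 0).obj C)).bijective.comp (key' P hP')
  have h₂ : Function.Bijective (fun g : (D.vert 1).obj C ⟶ (D.vert 1).obj P => D.dia C ≫ g) := by
    refine (Function.Bijective.of_comp_iff _ (vert_one_map_bijective C hP)).1 ?_
    refine (Eq.to_iff (congrArg _ (funext fun f => ?_))).1 h₁
    exact dia_naturality f
  have := (e.homToEquiv (Z := (D.vert 0).obj C)).bijective.comp
    (h₂.comp (e.symm.homToEquiv (Z := (D.vert 1).obj C)).bijective)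
  simpa [Function.comp_def] using this

/-- The local objects of a choric reflection form a choric class. -/
theorem isChoricClass_localObjects (hr : r.IsChoric) : r.localObjects.IsChoricClass where
  isClosedUnderIsomorphisms J := inferInstanceAs (r.right J).essImage.IsClosedUnderIsomorphisms
  pull_acyclic := r.pull_acyclic
  exists_isReflectionArrow J X := by
    obtain ⟨C, h₁, h₂, -⟩ := r.exists_isReflectionArrow hr J X
    exact ⟨C, h₁, h₂⟩
  bijective {J} C Y hC hY := by
    obtain ⟨C', hC', ⟨e⟩, h⟩ := r.exists_isReflectionArrow hr J ((D.vert 0).obj C)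
    obtain ⟨f, hf⟩ := (h C hC.2).2 e.hom
    have hf' : IsIso ((D.vert 0).map f) := by
      dsimp only at hf
      rw [hf]
      infer_instance
    have := hC'.isIso hC f hf'
    have h₁ : Function.Bijective (fun g : C ⟶ Y => (D.vert 0).map f ≫ (D.vert 0).map g) := by
      refine (Eq.to_iff (congrArg _ (funext fun g => ?_))).1
        ((h Y hY).comp (bijective_precomp_of_isIso f Y))
      exact (D.vert 0).map_comp f g
    exact (Function.Bijective.of_comp_iff' (bijective_precomp_of_isIso _ _) _).1 h₁

end Reflection

end Prederivator

namespace DiagramCategory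

variable {𝒦 : DiagramCategory.{w}}

/-! ### The diagonal of the square -/

variable (J : 𝒦.Obj)

/-- The diagonal `J × [1] ⥤ (J × [1]) × [1]`, `(j, a) ↦ ((j, a), a)`. -/
def diagonal : J.prod (𝒦.ord 1) ⥤ (J.prod (𝒦.ord 1)).prod (𝒦.ord 1) :=
  (𝟭 (J.prod (𝒦.ord 1))).prod' (CategoryTheory.Prod.snd J (𝒦.ord 1))

/-- The canonical arrows `((j, 0), a) ⟶ ((j, a), a)`. -/
def fromVertical : prodMap (slot J (𝒦.vertex (n := 1) 0)) (𝒦.ord 1) ⟶ diagonal J where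
  app x := ((𝟙 x.1, ordHom (Fin.zero_le (n := 2) (ULift.down x.2 : Fin 2))), 𝟙 x.2)
  naturality _ _ _ := Prod.ext (Prod.ext ((Category.comp_id _).trans (Category.id_comp _).symm)
    (ord_hom_subsingleton _ _)) (ord_hom_subsingleton _ _)

/-- The canonical arrows `((j, a), 0) ⟶ ((j, a), a)`. -/
def fromHorizontal : slot (J.prod (𝒦.ord 1)) (𝒦.vertex (n := 1) 0) ⟶ diagonal J where
  app x := (𝟙 x, ordHom (Fin.zero_le (n := 2) (ULift.down x.2 : Fin 2)))
  naturality _ _ _ := Prod.ext ((Category.comp_id _).trans (Category.id_comp _).symm)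
    (ord_hom_subsingleton _ _)

/-- The common restriction of `fromVertical` and `fromHorizontal` to `J × {0}` is invertible. -/
lemma isIso_whiskerLeft_fromVertical :
    IsIso (Functor.whiskerLeft (slot J (𝒦.vertex (n := 1) 0)) (fromVertical J)) := by
  have (j : J) : IsIso ((Functor.whiskerLeft (slot J (𝒦.vertex (n := 1) 0))
      (fromVertical J)).app j) :=
    ⟨((𝟙 j, 𝟙 _), 𝟙 _), Prod.ext (Prod.ext (Category.comp_id _) (ord_hom_subsingleton _ _))
      (ord_hom_subsingleton _ _), Prod.ext (Prod.ext (Category.comp_id _)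
        (ord_hom_subsingleton _ _)) (ord_hom_subsingleton _ _)⟩
  exact NatIso.isIso_of_isIso_app _

lemma isIso_whiskerLeft_fromHorizontal :
    IsIso (Functor.whiskerLeft (slot J (𝒦.vertex (n := 1) 0)) (fromHorizontal J)) := by
  have (j : J) : IsIso ((Functor.whiskerLeft (slot J (𝒦.vertex (n := 1) 0))
      (fromHorizontal J)).app j) :=
    ⟨((𝟙 j, 𝟙 _), 𝟙 _), Prod.ext (Prod.ext (Category.comp_id _) (ord_hom_subsingleton _ _))
      (ord_hom_subsingleton _ _), Prod.ext (Prod.ext (Category.comp_id _)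
        (ord_hom_subsingleton _ _)) (ord_hom_subsingleton _ _)⟩
  exact NatIso.isIso_of_isIso_app _

end DiagramCategory

namespace SubPrederivator

open DiagramCategory Prederivator

variable {𝒦 : DiagramCategory.{w}} {D : Prederivator.{w, v, u} 𝒦} {S : SubPrederivator D}
  {J : 𝒦.Obj}

lemma isIso_map_pull₂_of_whiskerLeft {I J K : 𝒦.Obj} (t : I ⥤ J) {u v : J ⥤ K} (α : u ⟶ v)
    (X : D.on K) (h : IsIso (Functor.whiskerLeft t α)) :
    IsIso ((D.pull t).map ((D.pull₂ α).app X)) := by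
  have := isIso_pull₂ (D := D) (Functor.whiskerLeft t α)
  exact ((MorphismProperty.isomorphisms _).arrow_mk_iso_iff (D.mapPullArrowIso t α X)).1
    (NatIso.isIso_app_of_isIso _ X)

/-- At the target, the morphism `W_0 ⟶ δ^* W` is the arrow underlying the restriction of `W` to
`{1} × [1]`. -/
def vertFromHorizontalIso (W : D.on ((J.prod (𝒦.ord 1)).prod (𝒦.ord 1))) :
    Arrow.mk (D.dia ((D.pull (prodMap (slot J (𝒦.vertex (n := 1) 1)) (𝒦.ord 1))).obj W)) ≅
      Arrow.mk ((D.vert 1).map ((D.pull₂ (fromHorizontal J)).app W)) :=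
  (D.pullArrowPullIso (slotMap J (𝒦.edge (i := 0) (j := 1) (Fin.zero_le _)))
      (prodMap (slot J (𝒦.vertex (n := 1) 1)) (𝒦.ord 1)) W).symm ≪≫
    D.pullArrowCongr
      (u := slot J (𝒦.vertex (n := 1) 0) ⋙ prodMap (slot J (𝒦.vertex (n := 1) 1)) (𝒦.ord 1))
      (v := slot J (𝒦.vertex (n := 1) 1) ⋙ prodMap (slot J (𝒦.vertex (n := 1) 1)) (𝒦.ord 1))
      (u' := slot J (𝒦.vertex (n := 1) 1) ⋙ slot (J.prod (𝒦.ord 1)) (𝒦.vertex (n := 1) 0))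
      (v' := slot J (𝒦.vertex (n := 1) 1) ⋙ diagonal J)
      (Functor.whiskerRight (slotMap J (𝒦.edge (i := 0) (j := 1) (Fin.zero_le _)))
        (prodMap (slot J (𝒦.vertex (n := 1) 1)) (𝒦.ord 1)))
      (Functor.whiskerLeft (slot J (𝒦.vertex (n := 1) 1)) (fromHorizontal J))
      (Iso.refl _) (Iso.refl _)
      (NatTrans.ext (funext fun _ => Prod.ext (Prod.ext rfl (ord_hom_subsingleton _ _))
        (ord_hom_subsingleton _ _))) W ≪≫
    D.mapPullArrowIso (slot J (𝒦.vertex (n := 1) 1)) (fromHorizontal J) W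

variable [IsDerivator D]

/-- If `W` is a reflection arrow over `J × [1]` whose source is an arrow with target in `S`, then
the reflection does not change this target, and `W_0 ⟶ δ^* W` is invertible. -/
lemma isIso_fromHorizontal (hiso : ∀ J : 𝒦.Obj, (S.mem J).IsClosedUnderIsomorphisms)
    (hpull : ∀ {J K : 𝒦.Obj} (u : J ⥤ K) (X : D.on (K.prod (𝒦.ord 1))),
      S.acyclic K X → S.acyclic J ((D.pull (prodMap u (𝒦.ord 1))).obj X))
    {W : D.on ((J.prod (𝒦.ord 1)).prod (𝒦.ord 1))} (hW : S.IsReflectionArrow W)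
    (h : S.mem J ((D.vert 1).obj ((D.vert 0).obj W))) :
    IsIso ((D.pull₂ (fromHorizontal J)).app W) := by
  have := hiso J
  refine isIso_of_vert _ fun i => ?_
  match i with
  | 0 => exact isIso_map_pull₂_of_whiskerLeft _ _ _ (isIso_whiskerLeft_fromHorizontal J)
  | 1 =>
    refine ((MorphismProperty.isomorphisms _).arrow_mk_iso_iff (vertFromHorizontalIso W)).1 ?_
    let s := slot J (𝒦.vertex (n := 1) 1)
    refine (ObjectProperty.isLocal_iff_isIso _ _ ?_ ?_).1 (hpull s W hW.1)
    · exact (S.mem J).prop_of_iso ((D.prodMapSlotIso s (𝒦.vertex (n := 1) 0)).symm.app W) h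
    · exact (S.mem J).prop_of_iso ((D.prodMapSlotIso s (𝒦.vertex (n := 1) 1)).symm.app W)
        (S.pull_mem s _ hW.2)

/-- In the definition of a choric class, it suffices to test the universal property of reflection
arrows on reflection arrows. For an arrow `Y` with `Y_1` in `S`, a reflection arrow
`W = [Y ⟶ L Y]` over `J × [1]` is a coherent square with corners `Y_0`, `Y_1`, `L Y_0`,
`L Y_1 ≅ Y_1`. Its diagonal is `Y`, so that the square amounts to a morphism
`[Y_0 ⟶ L Y_0] ⟶ Y`, natural in `Y`, which is the identity on sources. -/
theorem IsChoricClass.of_bijective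
    (hiso : ∀ J : 𝒦.Obj, (S.mem J).IsClosedUnderIsomorphisms)
    (hpull : ∀ {J K : 𝒦.Obj} (u : J ⥤ K) (X : D.on (K.prod (𝒦.ord 1))),
      S.acyclic K X → S.acyclic J ((D.pull (prodMap u (𝒦.ord 1))).obj X))
    (hex : ∀ (J : 𝒦.Obj) (X : D.on J),
      ∃ C : D.on (J.prod (𝒦.ord 1)), S.IsReflectionArrow C ∧ Nonempty ((D.vert 0).obj C ≅ X))
    (hbij : ∀ {J : 𝒦.Obj} (C C' : D.on (J.prod (𝒦.ord 1))), S.IsReflectionArrow C →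
      S.IsReflectionArrow C' → Function.Bijective (fun f : C ⟶ C' => (D.vert 0).map f)) :
    S.IsChoricClass := by
  refine ⟨hiso, hpull, hex, fun {J} C Y hC hY => ?_⟩
  have := hiso J
  let s := slot J (𝒦.vertex (n := 1) 0)
  let T := D.pull (prodMap s (𝒦.ord 1))
  let θ := D.pull₂ (fromVertical J)
  let ξ := D.pull₂ (fromHorizontal J)
  have hT {W : D.on ((J.prod (𝒦.ord 1)).prod (𝒦.ord 1))} (hW : S.IsReflectionArrow W) :
      S.IsReflectionArrow (T.obj W) :=
    ⟨hpull s W hW.1, (S.mem J).prop_of_iso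
      ((D.prodMapSlotIso s (𝒦.vertex (n := 1) 1)).symm.app W) (S.pull_mem s _ hW.2)⟩
  have hθ (W : D.on ((J.prod (𝒦.ord 1)).prod (𝒦.ord 1))) : IsIso ((D.vert 0).map (θ.app W)) :=
    isIso_map_pull₂_of_whiskerLeft _ _ _ (isIso_whiskerLeft_fromVertical J)
  have hξ {W : D.on ((J.prod (𝒦.ord 1)).prod (𝒦.ord 1))} (hW : S.IsReflectionArrow W)
      {Y : D.on (J.prod (𝒦.ord 1))} (e : (D.vert 0).obj W ≅ Y) (hY : S.mem J ((D.vert 1).obj Y)) :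
      IsIso (ξ.app W) :=
    isIso_fromHorizontal hiso hpull hW ((S.mem J).prop_of_iso ((D.vert 1).mapIso e).symm hY)
  obtain ⟨W, hW, ⟨e⟩⟩ := hex _ C
  obtain ⟨W', hW', ⟨e'⟩⟩ := hex _ Y
  have h₁ := hξ hW e hC.2
  have h₂ := hξ hW' e' hY
  constructor
  · intro g g' hg
    dsimp only at hg
    -- `[C_0 ⟶ L C_0] ⟶ C` is an isomorphism, as both sides are reflection arrows.
    have hθ₁ : IsIso (θ.app W) := by
      let φ : T.obj W ⟶ C := θ.app W ≫ inv (ξ.app W) ≫ e.hom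
      have := hθ W
      have hφ : IsIso φ := (hT hW).isIso hC φ (by
        rw [Functor.map_comp]
        infer_instance)
      exact IsIso.of_isIso_comp_right (θ.app W) (inv (ξ.app W) ≫ e.hom)
    obtain ⟨k, hk⟩ := (hbij W W' hW hW').2 (e.hom ≫ g ≫ e'.inv)
    obtain ⟨k', hk'⟩ := (hbij W W' hW hW').2 (e.hom ≫ g' ≫ e'.inv)
    dsimp only at hk hk'
    have hTk : T.map k = T.map k' := by
      refine (hbij _ _ (hT hW) (hT hW')).1 ?_
      have : (D.pull s).map ((D.vert 0).map k) = (D.pull s).map ((D.vert 0).map k') := by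
        rw [hk, hk']
        simp only [Functor.map_comp]
        exact congrArg (fun t => _ ≫ t ≫ _) hg
      have n := D.prodMapSlotIso s (𝒦.vertex (n := 1) 0)
      exact (NatIso.naturality_1 n.symm k).symm.trans
        ((congrArg (fun t => n.symm.inv.app W ≫ t ≫ n.symm.hom.app W') this).trans
          (NatIso.naturality_1 n.symm k'))
    have hδ : (D.pull (diagonal J)).map k = (D.pull (diagonal J)).map k' := by
      rw [← cancel_epi (θ.app W)]
      exact (θ.naturality k).symm.trans ((congrArg (· ≫ _) hTk).trans (θ.naturality k'))
    have h₀ : (D.vert 0).map k = (D.vert 0).map k' := by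
      rw [← cancel_mono (ξ.app W')]
      exact (ξ.naturality k).trans ((congrArg (_ ≫ ·) hδ).trans (ξ.naturality k').symm)
    rw [hk, hk'] at h₀
    simpa using h₀
  · intro h
    let φ : T.obj W' ⟶ Y := θ.app W' ≫ inv (ξ.app W') ≫ e'.hom
    have hφ : IsIso ((D.vert 0).map φ) := by
      have := hθ W'
      rw [Functor.map_comp]
      infer_instance
    obtain ⟨m, hm⟩ := (hbij C _ hC (hT hW')).2 (h ≫ inv ((D.vert 0).map φ))
    dsimp only at hm
    exact ⟨m ≫ φ, by dsimp only; rw [Functor.map_comp, hm, Category.assoc, IsIso.inv_hom_id,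
      Category.comp_id]⟩

end SubPrederivator

namespace DiagramCategory

variable {𝒦 : DiagramCategory.{w}}

/-! ### Paths in the square -/

/-- The monotone map `[2] ⥤ [1]` with `0 ↦ 0`, `1 ↦ 0`, `2 ↦ 1`. -/
def lastStep (𝒦 : DiagramCategory.{w}) : 𝒦.ord 2 ⥤ 𝒦.ord 1 :=
  Monotone.functor (X := Chain.{w} 3) (Y := Chain.{w} 2)
    (f := fun x => ULift.up (if ULift.down x = 2 then 1 else 0)) (by
      rintro ⟨x⟩ ⟨y⟩ hxy
      change (if x = 2 then 1 else 0 : Fin 2) ≤ (if y = 2 then 1 else 0)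
      have hxy' : x ≤ y := hxy
      clear hxy
      revert x y
      decide)

lemma ord_functor_ext {A : 𝒦.Obj} {n : ℕ} {F G : A ⥤ 𝒦.ord n} (h : ∀ x, F.obj x = G.obj x) :
    F = G :=
  CategoryTheory.Functor.ext h (fun _ _ _ => ord_hom_subsingleton _ _)

/-- The functor `J × K ⥤ (J × [1]) × [1]` over `J` given by the two coordinates `K ⥤ [1]`. -/
def path (J : 𝒦.Obj) {K : 𝒦.Obj} (a b : K ⥤ 𝒦.ord 1) :
    J.prod K ⥤ (J.prod (𝒦.ord 1)).prod (𝒦.ord 1) :=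
  (prodMapRight J a).prod' (CategoryTheory.Prod.snd J K ⋙ b)

end DiagramCategory

namespace Prederivator

open DiagramCategory

variable {𝒦 : DiagramCategory.{w}} (D : Prederivator.{w, v, u} 𝒦) {J : 𝒦.Obj}

/-- The edges of the restriction along a path `J × [2] ⥤ (J × [1]) × [1]`. -/
def edgePathIso {i j : Fin 3} (h : i ≤ j) {a b : 𝒦.ord 2 ⥤ 𝒦.ord 1}
    {a' b' : 𝒦.ord 1 ⥤ 𝒦.ord 1} (ha : ∀ x : Fin 2, (𝒦.face h ⋙ a).obj ⟨x⟩ = a'.obj ⟨x⟩)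
    (hb : ∀ x : Fin 2, (𝒦.face h ⋙ b).obj ⟨x⟩ = b'.obj ⟨x⟩)
    (W : D.on ((J.prod (𝒦.ord 1)).prod (𝒦.ord 1))) :
    (D.edge h).obj ((D.pull (path J a b)).obj W) ≅ (D.pull (path J a' b')).obj W :=
  (D.pullCompIso (u := prodMapRight J (𝒦.face h)) (v := path J a b) (t := path J a' b')
    (eqToIso (by
      have ha' : 𝒦.face h ⋙ a = a' := ord_functor_ext fun x => ha x.down
      have hb' : 𝒦.face h ⋙ b = b' := ord_functor_ext fun x => hb x.down
      rw [← ha', ← hb']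
      rfl))).app W

variable {D}

/-- A class of coherent arrows which is closed under isomorphisms and satisfies the 3-for-2
property, formulated for coherent composable pairs. -/
structure IsThreeForTwo (P : ObjectProperty (D.on (J.prod (𝒦.ord 1)))) : Prop where
  of_iso : ∀ {X Y : D.on (J.prod (𝒦.ord 1))}, (X ≅ Y) → P X → P Y
  comp_mem : ∀ X : D.on (J.prod (𝒦.ord 2)),
    P ((D.edge (i := 0) (j := 1) (by decide)).obj X) →
    P ((D.edge (i := 1) (j := 2) (by decide)).obj X) →
    P ((D.edge (i := 0) (j := 2) (by decide)).obj X)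
  of_precomp_mem : ∀ X : D.on (J.prod (𝒦.ord 2)),
    P ((D.edge (i := 0) (j := 1) (by decide)).obj X) →
    P ((D.edge (i := 0) (j := 2) (by decide)).obj X) →
    P ((D.edge (i := 1) (j := 2) (by decide)).obj X)
  of_postcomp_mem : ∀ X : D.on (J.prod (𝒦.ord 2)),
    P ((D.edge (i := 1) (j := 2) (by decide)).obj X) →
    P ((D.edge (i := 0) (j := 2) (by decide)).obj X) →
    P ((D.edge (i := 0) (j := 1) (by decide)).obj X)

/-- If the vertical arrows of a coherent square `W` belong to a 3-for-2 class, then the horizontal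
arrow `W_0` belongs to it if and only if `W_1` does: the two paths through the square have the same
composite, the diagonal. -/
lemma IsThreeForTwo.vert_mem_iff {P : ObjectProperty (D.on (J.prod (𝒦.ord 1)))}
    (hP : IsThreeForTwo P) (W : D.on ((J.prod (𝒦.ord 1)).prod (𝒦.ord 1)))
    (hW : ∀ i : Fin 2, P ((D.pull (prodMap (slot J (𝒦.vertex (n := 1) i)) (𝒦.ord 1))).obj W)) :
    P ((D.vert 0).obj W) ↔ P ((D.vert 1).obj W) := by
  let c (i : Fin 2) : 𝒦.ord 1 ⥤ 𝒦.ord 1 := (Functor.const _).obj (𝒦.vertex i)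
  let X₁ := (D.pull (path J (lastStep 𝒦) (truncate 𝒦))).obj W
  let X₂ := (D.pull (path J (truncate 𝒦) (lastStep 𝒦))).obj W
  let e₁ : (D.edge (i := 0) (j := 1) (by decide)).obj X₁ ≅
      (D.pull (prodMap (slot J (𝒦.vertex (n := 1) 0)) (𝒦.ord 1))).obj W :=
    D.edgePathIso _ (a' := c 0) (b' := 𝟭 _) (fun x => by fin_cases x <;> rfl)
      (fun x => by fin_cases x <;> rfl) W
  let e₂ : (D.edge (i := 1) (j := 2) (by decide)).obj X₁ ≅ (D.vert 1).obj W :=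
    D.edgePathIso _ (a' := 𝟭 _) (b' := c 1) (fun x => by fin_cases x <;> rfl)
      (fun x => by fin_cases x <;> rfl) W
  let e₃ : (D.edge (i := 0) (j := 2) (by decide)).obj X₁ ≅ (D.pull (path J (𝟭 _) (𝟭 _))).obj W :=
    D.edgePathIso _ (fun x => by fin_cases x <;> rfl) (fun x => by fin_cases x <;> rfl) W
  let e₄ : (D.edge (i := 0) (j := 1) (by decide)).obj X₂ ≅ (D.vert 0).obj W :=
    D.edgePathIso _ (a' := 𝟭 _) (b' := c 0) (fun x => by fin_cases x <;> rfl)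
      (fun x => by fin_cases x <;> rfl) W
  let e₅ : (D.edge (i := 1) (j := 2) (by decide)).obj X₂ ≅
      (D.pull (prodMap (slot J (𝒦.vertex (n := 1) 1)) (𝒦.ord 1))).obj W :=
    D.edgePathIso _ (a' := c 1) (b' := 𝟭 _) (fun x => by fin_cases x <;> rfl)
      (fun x => by fin_cases x <;> rfl) W
  let e₆ : (D.edge (i := 0) (j := 2) (by decide)).obj X₂ ≅ (D.pull (path J (𝟭 _) (𝟭 _))).obj W :=
    D.edgePathIso _ (fun x => by fin_cases x <;> rfl) (fun x => by fin_cases x <;> rfl) W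
  have h₁ := hP.of_iso e₁.symm (hW 0)
  have h₅ := hP.of_iso e₅.symm (hW 1)
  constructor
  · intro h
    have h₆ := hP.comp_mem X₂ (hP.of_iso e₄.symm h) h₅
    exact hP.of_iso e₂ (hP.of_precomp_mem X₁ h₁ (hP.of_iso (e₆ ≪≫ e₃.symm) h₆))
  · intro h
    have h₃ := hP.comp_mem X₁ h₁ (hP.of_iso e₂.symm h)
    exact hP.of_iso e₄ (hP.of_postcomp_mem X₂ h₅ (hP.of_iso (e₃ ≪≫ e₆.symm) h₃))

lemma slotMap_comp {n : ℕ} {i j k : Fin (n + 1)} (h : i ≤ j) (h' : j ≤ k) :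
    slotMap J (𝒦.edge h) ≫ slotMap J (𝒦.edge h') = slotMap J (𝒦.edge (h.trans h')) :=
  NatTrans.ext (funext fun _ => Prod.ext (Category.comp_id _) (ord_hom_subsingleton _ _))

end Prederivator

namespace SubPrederivator

open DiagramCategory Prederivator

variable {𝒦 : DiagramCategory.{w}} {D : Prederivator.{w, v, u} 𝒦} (S : SubPrederivator D)

lemma isThreeForTwo_acyclic (J : 𝒦.Obj) : IsThreeForTwo (S.acyclic J) := by
  have e (X : D.on (J.prod (𝒦.ord 2))) :
      (D.pull₂ (slotMap J (𝒦.edge (n := 2) (i := 0) (j := 1) (by decide)))).app X ≫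
      (D.pull₂ (slotMap J (𝒦.edge (n := 2) (i := 1) (j := 2) (by decide)))).app X =
      (D.pull₂ (slotMap J (𝒦.edge (n := 2) (i := 0) (j := 2) (by decide)))).app X := by
    rw [← slotMap_comp (J := J) (𝒦 := 𝒦) (n := 2) (i := 0) (j := 1) (k := 2) (by decide)
      (by decide), pull₂_comp]
    rfl
  refine ⟨fun i h => acyclic_of_iso i h, fun X h h' => ?_, fun X h h' => ?_, fun X h h' => ?_⟩ <;>
    rw [acyclic_edge_iff] at h h' ⊢
  · rw [← e]
    exact (S.mem J).isLocal.comp_mem _ _ h h'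
  · exact (S.mem J).isLocal.of_precomp _ _ h ((e X).symm ▸ h')
  · exact (S.mem J).isLocal.of_postcomp _ _ h ((e X).symm ▸ h')

end SubPrederivator

namespace Prederivator

open DiagramCategory

variable {𝒦 : DiagramCategory.{w}} {D : Prederivator.{w, v, u} 𝒦} [IsDerivator D] {J : 𝒦.Obj}

/-! ### Factorizations of terminal arrows -/

lemma map_bijective_congr {C E : Type*} [Category* C] [Category* E] {F G : C ⥤ E} (e : F ≅ G)
    (X Y : C) : Function.Bijective (fun f : X ⟶ Y => F.map f) ↔
      Function.Bijective (fun f : X ⟶ Y => G.map f) := by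
  refine (Function.Bijective.of_comp_iff' ((e.app X).homCongr (e.app Y)).bijective _).symm.trans
    (Eq.to_iff (congrArg _ (funext fun f => ?_)))
  exact NatIso.naturality_1 e f

lemma map_bijective_congr_obj {C E : Type*} [Category* C] [Category* E] (F : C ⥤ E)
    {X X' Y Y' : C} (i : X ≅ X') (j : Y ≅ Y') :
    Function.Bijective (fun f : X ⟶ Y => F.map f) ↔
      Function.Bijective (fun f : X' ⟶ Y' => F.map f) := by
  refine (Function.Bijective.of_comp_iff'
    ((F.mapIso i).homCongr (F.mapIso j)).bijective _).symm.trans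
      (Iff.trans (Eq.to_iff (congrArg _ (funext fun f => ?_)))
      (Function.Bijective.of_comp_iff _ (i.homCongr j).bijective))
  simp [Iso.homCongr]

lemma ι_comp_map_bijective_iff {C E : Type*} [Category* C] [Category* E] (P : ObjectProperty C)
    (F : C ⥤ E) (X Y : P.FullSubcategory) :
    Function.Bijective (fun f : X ⟶ Y => (P.ι ⋙ F).map f) ↔
      Function.Bijective (fun f : X.obj ⟶ Y.obj => F.map f) :=
  Function.Bijective.of_comp_iff (fun f : X.obj ⟶ Y.obj => F.map f)
    (P.fullyFaithfulι.homEquiv (X := X) (Y := Y)).bijective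

/-- For objects of `D^{[2]}` with terminal final vertices, passing to the composite is fully
faithful precisely if passing from the initial edge to its source is so. -/
lemma edge_map_bijective_iff (X : D.on (J.prod (𝒦.ord 2))) {Y : D.on (J.prod (𝒦.ord 2))}
    (hY : Nonempty (Limits.IsTerminal ((D.vert 2).obj Y))) :
    Function.Bijective (fun f : X ⟶ Y =>
        (D.edge (n := 2) (i := 0) (j := 2) (by decide)).map f) ↔
      Function.Bijective (fun f : (D.edge (n := 2) (i := 0) (j := 1) (by decide)).obj X ⟶
        (D.edge (n := 2) (i := 0) (j := 1) (by decide)).obj Y => (D.vert 0).map f) := by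
  have hY' : Nonempty (Limits.IsTerminal ((D.vert 1).obj
      ((D.edge (n := 2) (i := 0) (j := 2) (by decide)).obj Y))) :=
    ⟨hY.some.ofIso ((D.edgeVertOneIso J _).symm.app Y)⟩
  have h₁ := map_bijective_congr (D.edgeVertZeroIso J (n := 2) (i := 0) (j := 2) (by decide) ≪≫
    (D.edgeVertZeroIso J (n := 2) (i := 0) (j := 1) (by decide)).symm) X Y
  have h₂ := Function.Bijective.of_comp_iff'
    (vert_zero_map_bijective ((D.edge (n := 2) (i := 0) (j := 2) (by decide)).obj X) hY')
    (fun f : X ⟶ Y => (D.edge (n := 2) (i := 0) (j := 2) (by decide)).map f)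
  have h₃ := Function.Bijective.of_comp_iff
    (fun f : (D.edge (n := 2) (i := 0) (j := 1) (by decide)).obj X ⟶
        (D.edge (n := 2) (i := 0) (j := 1) (by decide)).obj Y => (D.vert 0).map f)
    (pull_map_bijective (initialFace J) (isIso_initialFace_unit hY) X)
  exact h₂.symm.trans (h₁.trans h₃)

namespace PrefactorizationSystem

variable (F : PrefactorizationSystem D)

lemma E_mem_of_iso {X Y : D.on (J.prod (𝒦.ord 1))} (e : X ≅ Y) (h : F.E.mem J X) :
    F.E.mem J Y :=
  (F.left_orthogonal J Y).2 fun Z hZ =>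
    Orthogonal.of_iso_left e.symm ((F.left_orthogonal J X).1 h Z hZ)

lemma M_mem_of_iso {X Y : D.on (J.prod (𝒦.ord 1))} (e : X ≅ Y) (h : F.M.mem J X) :
    F.M.mem J Y :=
  (F.right_orthogonal J Y).2 fun Z hZ =>
    Orthogonal.of_iso_right e ((F.right_orthogonal J X).1 h Z hZ)

lemma E_mem_of_isIso_dia {X : D.on (J.prod (𝒦.ord 1))} (h : IsIso (D.dia X)) : F.E.mem J X :=
  (F.left_orthogonal J X).2 fun Y _ => orthogonal_of_isIso_dia h Y

/-- The class of objects whose terminal arrow belongs to the right class. -/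
def localObjects : SubPrederivator D where
  mem J Y := F.M.mem J ((D.terminalArrow J).obj Y)
  pull_mem u X h := F.M_mem_of_iso (pullTerminalArrowIso u X) (F.M.pull_mem u _ h)

lemma localObjects_mem_of_iso {X Y : D.on J} (e : X ≅ Y) (h : F.localObjects.mem J X) :
    F.localObjects.mem J Y :=
  F.M_mem_of_iso ((D.terminalArrow J).mapIso e) h

instance : (F.localObjects.mem J).IsClosedUnderIsomorphisms where
  of_iso e h := F.localObjects_mem_of_iso e h

lemma acyclic_of_E_mem {X : D.on (J.prod (𝒦.ord 1))} (h : F.E.mem J X) :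
    F.localObjects.acyclic J X :=
  (SubPrederivator.acyclic_iff_orthogonal X).2 fun _ hB => (F.left_orthogonal J X).1 h _ hB

lemma M_mem_iff {X : D.on (J.prod (𝒦.ord 1))}
    (h : Nonempty (Limits.IsTerminal ((D.vert 1).obj X))) :
    F.M.mem J X ↔ F.localObjects.mem J ((D.vert 0).obj X) :=
  ⟨F.M_mem_of_iso (isoTerminalArrow h), F.M_mem_of_iso (isoTerminalArrow h).symm⟩

/-- An object of `D^{[2]}` with terminal final vertex lies in `D_F` if its initial edge lies in `E`
and has a local target. -/
lemma factorizations_iff {X : D.on (J.prod (𝒦.ord 2))}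
    (h : Nonempty (Limits.IsTerminal ((D.vert 2).obj X))) :
    F.factorizations J X ↔ F.E.mem J ((D.edge (i := 0) (j := 1) (by decide)).obj X) ∧
      F.localObjects.mem J
        ((D.vert 1).obj ((D.edge (i := 0) (j := 1) (by decide)).obj X)) := by
  have e := (D.edgeVertZeroIso J (n := 2) (i := 1) (j := 2) (by decide)).app X ≪≫
    ((D.edgeVertOneIso J (n := 2) (i := 0) (j := 1) (by decide)).app X).symm
  refine and_congr_right fun _ => (F.M_mem_iff ?_).trans
    ⟨F.localObjects_mem_of_iso e, F.localObjects_mem_of_iso e.symm⟩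
  exact ⟨h.some.ofIso ((D.edgeVertOneIso J _).symm.app X)⟩

lemma extend_mem_factorizations {C : D.on (J.prod (𝒦.ord 1))} (hC : F.E.mem J C)
    (hC' : F.localObjects.mem J ((D.vert 1).obj C)) :
    F.factorizations J ((extend J).obj C) :=
  (F.factorizations_iff (isTerminal_vert_extend C)).2
    ⟨F.E_mem_of_iso (edgeExtendIso C).symm hC,
      F.localObjects_mem_of_iso ((D.vert 1).mapIso (edgeExtendIso C).symm) hC'⟩

/-- The objects of `D_F` over terminal arrows are those with terminal final vertex. -/
lemma essImage_comp_iff (X : D.on (J.prod (𝒦.ord 2))) :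
    (D.terminalArrow J).essImage ((D.edge (i := 0) (j := 2) (by decide)).obj X) ↔
      Nonempty (Limits.IsTerminal ((D.vert 2).obj X)) := by
  rw [essImage_terminalArrow_iff]
  have e := (D.edgeVertOneIso J (n := 2) (i := 0) (j := 2) (by decide)).app X
  exact ⟨fun ⟨h⟩ => ⟨h.ofIso e⟩, fun ⟨h⟩ => ⟨h.ofIso e.symm⟩⟩

/-- Being `τ`-choric means that arrows in `E` with local target are determined by their sources. -/
lemma isTauChoric_iff : F.IsTauChoric ↔ ∀ (J : 𝒦.Obj) (C C' : D.on (J.prod (𝒦.ord 1))),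
    F.E.mem J C → F.localObjects.mem J ((D.vert 1).obj C) →
    F.E.mem J C' → F.localObjects.mem J ((D.vert 1).obj C') →
      Function.Bijective (fun f : C ⟶ C' => (D.vert 0).map f) := by
  constructor
  · intro h J C C' h₁ h₂ h₃ h₄
    let Z (C : D.on (J.prod (𝒦.ord 1))) (h₁ : F.E.mem J C)
        (h₂ : F.localObjects.mem J ((D.vert 1).obj C)) :
        (F.terminalFactorizations J).FullSubcategory :=
      ⟨⟨(extend J).obj C, F.extend_mem_factorizations h₁ h₂⟩,
        (essImage_comp_iff _).2 (isTerminal_vert_extend C)⟩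
    have := h.full J
    have := h.faithful J
    have h₅ := (Functor.FullyFaithful.ofFullyFaithful ((F.terminalFactorizations J).ι ⋙
      F.comp J)).map_bijective (Z C h₁ h₂) (Z C' h₃ h₄)
    have h₈ := (ι_comp_map_bijective_iff _ _ _ _).1 ((ι_comp_map_bijective_iff _ _ _ _).1 h₅)
    exact (map_bijective_congr_obj (D.vert 0) (edgeExtendIso C) (edgeExtendIso C')).1
      ((edge_map_bijective_iff _ (isTerminal_vert_extend C')).1 h₈)
  · intro h
    have key (J : 𝒦.Obj) (Z W : (F.terminalFactorizations J).FullSubcategory) :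
        Function.Bijective (fun f : Z ⟶ W =>
          ((F.terminalFactorizations J).ι ⋙ F.comp J).map f) := by
      have hZ := (essImage_comp_iff _).1 Z.property
      have hW := (essImage_comp_iff _).1 W.property
      have hZ' := (F.factorizations_iff hZ).1 Z.obj.property
      have hW' := (F.factorizations_iff hW).1 W.obj.property
      exact (ι_comp_map_bijective_iff _ _ _ _).2 ((ι_comp_map_bijective_iff _ _ _ _).2
        ((edge_map_bijective_iff _ hW).2 (h J _ _ hZ'.1 hZ'.2 hW'.1 hW'.2)))
    exact ⟨fun J => ⟨fun {Z W} => (key J Z W).2⟩, fun J => ⟨fun {Z W} _ _ e => (key J Z W).1 e⟩⟩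

end PrefactorizationSystem

end Prederivator

namespace SubPrederivator

open DiagramCategory Prederivator

variable {𝒦 : DiagramCategory.{w}} {D : Prederivator.{w, v, u} 𝒦} [IsDerivator D]
  {S : SubPrederivator D} {J K : 𝒦.Obj}

/-! ### The prefactorization system of a choric class -/

lemma acyclic_lan (u : J ⥤ K) {X : D.on (J.prod (𝒦.ord 1))} (h : S.acyclic J X) :
    S.acyclic K ((D.lan (prodMap u (𝒦.ord 1))).obj X) :=
  (acyclic_iff_orthogonal _).2 fun B hB => (orthogonal_pull_iff u X _).1
    (Orthogonal.of_iso_right (pullTerminalArrowIso u B).symm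
      ((acyclic_iff_orthogonal X).1 h _ (S.pull_mem u B hB)))

namespace IsChoricClass

variable (hS : S.IsChoricClass)

/-- The prefactorization system whose left class consists of the acyclic arrows of a choric
class. -/
def acyclicSystem : PrefactorizationSystem D where
  E :=
    { mem := S.acyclic
      pull_mem := hS.pull_acyclic }
  M :=
    { mem J Y := ∀ X, S.acyclic J X → D.Orthogonal X Y
      pull_mem u Y hY X hX := (orthogonal_pull_iff u X Y).2 (hY _ (acyclic_lan u hX)) }
  left_orthogonal _ X := ⟨fun h _ hY => hY X h, fun h => (acyclic_iff_orthogonal X).2 fun _ hB =>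
    h _ fun X' hX' => (acyclic_iff_orthogonal X').1 hX' _ hB⟩
  right_orthogonal _ _ := Iff.rfl

/-- If all acyclic arrows are orthogonal to the terminal arrow of `Y`, then the reflection arrow of
`Y` has a retraction, and is therefore invertible. -/
lemma localObjects_acyclicSystem : hS.acyclicSystem.localObjects = S := by
  refine SubPrederivator.ext (funext fun J => ?_)
  have := hS.isClosedUnderIsomorphisms J
  ext Y
  refine ⟨fun h => ?_, fun h X hX => (acyclic_iff_orthogonal X).1 hX Y h⟩
  obtain ⟨C, hC, ⟨e⟩⟩ := hS.exists_isReflectionArrow J Y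
  obtain ⟨s, hs⟩ := ((orthogonal_terminalArrow_iff C Y).1 (h C hC.1)).2 e.hom
  dsimp only at hs
  have h₁ : D.dia C ≫ s ≫ e.inv = 𝟙 _ := by
    rw [← Category.assoc, hs, e.hom_inv_id]
  have h₂ : (s ≫ e.inv) ≫ D.dia C = 𝟙 _ := by
    refine (hC.1 _ hC.2).1 ?_
    dsimp only
    rw [← Category.assoc, h₁, Category.id_comp, Category.comp_id]
  exact (S.mem J).prop_of_iso ((Iso.mk _ _ h₁ h₂).symm ≪≫ e) hC.2

lemma isReflective_acyclicSystem : hS.acyclicSystem.IsReflective where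
  comp_mem J := (S.isThreeForTwo_acyclic J).comp_mem
  of_precomp_mem J := (S.isThreeForTwo_acyclic J).of_precomp_mem
  of_postcomp_mem J := (S.isThreeForTwo_acyclic J).of_postcomp_mem
  factor J X := by
    obtain ⟨C, hC, ⟨e⟩⟩ := hS.exists_isReflectionArrow J X
    refine ⟨⟨(extend J).obj C, hS.acyclicSystem.extend_mem_factorizations hC.1
      (by rw [localObjects_acyclicSystem]; exact hC.2)⟩, ⟨?_⟩⟩
    have h := (essImage_terminalArrow_iff _).1
      ((PrefactorizationSystem.essImage_comp_iff _).2 (isTerminal_vert_extend C))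
    exact isoTerminalArrow h ≪≫ (D.terminalArrow J).mapIso
      ((D.edgeVertZeroIso J (n := 2) (i := 0) (j := 2) (by decide) ≪≫
        (D.edgeVertZeroIso J (n := 2) (i := 0) (j := 1) (by decide)).symm).app _ ≪≫
          (D.vert 0).mapIso (edgeExtendIso C) ≪≫ e)

lemma isTauChoric_acyclicSystem : hS.acyclicSystem.IsTauChoric := by
  rw [PrefactorizationSystem.isTauChoric_iff, localObjects_acyclicSystem]
  exact fun J C C' h₁ h₂ _ h₄ => hS.bijective C C' ⟨h₁, h₂⟩ h₄

end IsChoricClass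

end SubPrederivator

namespace Prederivator

open DiagramCategory

variable {𝒦 : DiagramCategory.{w}} {D : Prederivator.{w, v, u} 𝒦} [IsDerivator D]

namespace PrefactorizationSystem

/-! ### The choric class of a prefactorization system -/

variable {F : PrefactorizationSystem D}

lemma IsReflective.isThreeForTwo (hF : F.IsReflective) (J : 𝒦.Obj) :
    IsThreeForTwo (J := J) (F.E.mem J) where
  of_iso e h := F.E_mem_of_iso e h
  comp_mem := hF.comp_mem J
  of_precomp_mem := hF.of_precomp_mem J
  of_postcomp_mem := hF.of_postcomp_mem J

/-- Factorizing the terminal arrow of `X` yields an arrow in `E` from `X` to a local object. -/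
lemma IsReflective.exists_E_mem (hF : F.IsReflective) (J : 𝒦.Obj) (X : D.on J) :
    ∃ C : D.on (J.prod (𝒦.ord 1)), F.E.mem J C ∧ F.localObjects.mem J ((D.vert 1).obj C) ∧
      Nonempty ((D.vert 0).obj C ≅ X) := by
  obtain ⟨Z, ⟨e⟩⟩ := hF.factor J X
  obtain ⟨h₁, h₂⟩ := (F.factorizations_iff ((essImage_comp_iff _).1 ⟨X, ⟨e.symm⟩⟩)).1 Z.property
  exact ⟨_, h₁, h₂, ⟨(D.edgeVertZeroIso J (n := 2) (i := 0) (j := 1) (by decide) ≪≫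
    (D.edgeVertZeroIso J (n := 2) (i := 0) (j := 2) (by decide)).symm).app _ ≪≫
      (D.vert 0).mapIso e ≪≫ terminalArrowVertIso X⟩⟩

/-- The left class is determined by the local objects. For an arrow `X`, an arrow `W` in `E` from
`X` to a local object over `J × [1]` is a coherent square whose vertical arrows lie in `E`. By the
3-for-2 property, `X` is acyclic (lies in `E`) if and only if `W_1` is acyclic (lies in `E`). As
both vertices of `W_1` are local, it is acyclic only if it is invertible. -/
lemma IsReflective.E_mem_iff (hF : F.IsReflective) {J : 𝒦.Obj} (X : D.on (J.prod (𝒦.ord 1))) :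
    F.E.mem J X ↔ F.localObjects.acyclic J X := by
  refine ⟨F.acyclic_of_E_mem, fun h => ?_⟩
  obtain ⟨W, hW, hW', ⟨e⟩⟩ := hF.exists_E_mem _ X
  have hE (i : Fin 2) := F.E.pull_mem (slot J (𝒦.vertex (n := 1) i)) W hW
  have h₁ : F.localObjects.acyclic J ((D.vert 1).obj W) :=
    ((F.localObjects.isThreeForTwo_acyclic J).vert_mem_iff W
      fun i => F.acyclic_of_E_mem (hE i)).1 (SubPrederivator.acyclic_of_iso e.symm h)
  have h₂ : IsIso (D.dia ((D.vert 1).obj W)) := (ObjectProperty.isLocal_iff_isIso _ _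
    (F.localObjects.pull_mem _ _ hW') (F.localObjects.pull_mem _ _ hW')).1 h₁
  exact F.E_mem_of_iso e
    (((hF.isThreeForTwo J).vert_mem_iff W hE).2 (F.E_mem_of_isIso_dia h₂))

/-- The local objects of a reflective `τ`-choric prefactorization system form a choric class. -/
theorem isChoricClass_localObjects (hF : F.IsReflective) (hF' : F.IsTauChoric) :
    F.localObjects.IsChoricClass :=
  .of_bijective (fun _ => inferInstance)
    (fun u X h => (hF.E_mem_iff _).1 (F.E.pull_mem u X ((hF.E_mem_iff X).2 h)))
    (fun J X => by
      obtain ⟨C, h₁, h₂, h₃⟩ := hF.exists_E_mem J X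
      exact ⟨C, ⟨F.acyclic_of_E_mem h₁, h₂⟩, h₃⟩)
    (fun {J} C C' hC hC' => F.isTauChoric_iff.1 hF' J C C' ((hF.E_mem_iff C).2 hC.1) hC.2
      ((hF.E_mem_iff C').2 hC'.1) hC'.2)

end PrefactorizationSystem

/-! ### The isomorphism of posets -/

lemma acyclicSystem_le_iff {S S' : SubPrederivator D} (hS : S.IsChoricClass)
    (hS' : S'.IsChoricClass) :
    hS.acyclicSystem ≤ hS'.acyclicSystem ↔ ∀ J, S.mem J ≤ S'.mem J := by
  constructor
  · intro h J Y hY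
    rw [← hS.localObjects_acyclicSystem] at hY
    rw [← hS'.localObjects_acyclicSystem]
    exact h J _ hY
  · intro h J Y hY X hX
    exact hY X fun B hB => hX B (h J B hB)

/-- The prefactorization system of a choric reflection. -/
def ChoricReflection.system (r : ChoricReflection D) : ReflectiveTauChoricSystem D :=
  ⟨(r.1.isChoricClass_localObjects r.2).acyclicSystem,
    (r.1.isChoricClass_localObjects r.2).isReflective_acyclicSystem,
    (r.1.isChoricClass_localObjects r.2).isTauChoric_acyclicSystem⟩

lemma ChoricReflection.system_le_system_iff (r r' : ChoricReflection D) :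
    r.system ≤ r'.system ↔ r ≤ r' :=
  acyclicSystem_le_iff (r.1.isChoricClass_localObjects r.2) (r'.1.isChoricClass_localObjects r'.2)

lemma ChoricReflection.system_surjective :
    Function.Surjective (ChoricReflection.system (D := D)) := by
  rintro ⟨F, hF, hF'⟩
  obtain ⟨r, hr⟩ :=
    (PrefactorizationSystem.isChoricClass_localObjects hF hF').exists_choricReflection
  have hr' : r.1.localObjects = F.localObjects := SubPrederivator.ext (funext hr)
  have hE : r.system.1.E = F.E := SubPrederivator.ext (funext fun J => by
    ext X
    refine Iff.trans (Eq.to_iff ?_) (hF.E_mem_iff X).symm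
    rw [← hr']
    rfl)
  refine ⟨r, Subtype.ext (PrefactorizationSystem.ext hE (SubPrederivator.ext (funext fun J => ?_)))⟩
  ext Y
  refine (r.system.1.right_orthogonal J Y).trans (Iff.trans ?_ (F.right_orthogonal J Y).symm)
  rw [hE]

lemma ChoricReflection.system_eq_of_antisymmRel (r r' : ChoricReflection D)
    (h : AntisymmRel (· ≤ ·) r r') : r.system = r'.system :=
  le_antisymm ((r.system_le_system_iff r').2 h.1) ((r'.system_le_system_iff r).2 h.2)

variable (D) in
/-- The isomorphism from the poset of choric reflections to the poset of reflective `τ`-choric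
prefactorization systems. -/
noncomputable def systemOrderIso : D.ChoricReflectionPoset ≃o D.ReflectiveTauChoricSystem :=
  RelIso.ofSurjective (OrderEmbedding.ofMapLEIff (α := D.ChoricReflectionPoset)
      (Quotient.lift ChoricReflection.system ChoricReflection.system_eq_of_antisymmRel) (by
        rintro ⟨r⟩ ⟨r'⟩
        exact r.system_le_system_iff r'))
    fun F => (ChoricReflection.system_surjective F).imp' (toAntisymmetrization (· ≤ ·))
      fun _ h => h

end Prederivator

theorem mainTheorem3 {𝒦 : DiagramCategory.{w}} (D : Prederivator.{w, v, u} 𝒦)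
    [Prederivator.IsDerivator D] :
    ∃ Φ : D.ChoricReflectionPoset ≃o D.ReflectiveTauChoricSystem,
      ∀ (r : D.ChoricReflection) (J : 𝒦.Obj),
        (∀ X : D.on (J.prod (𝒦.ord 1)),
          (Φ (toAntisymmetrization (· ≤ ·) r)).1.E.mem J X ↔ r.1.inverted J X) ∧
        (∀ Y : D.on J, (r.1.right J).essImage Y ↔
          (Φ (toAntisymmetrization (· ≤ ·) r)).1.M.mem J ((D.terminalArrow J).obj Y)) := by
  refine ⟨D.systemOrderIso, fun r J => ⟨fun X => r.1.acyclic_iff_inverted X, fun Y => ?_⟩⟩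
  have h := (r.1.isChoricClass_localObjects r.2).localObjects_acyclicSystem
  exact Eq.to_iff (congrArg (fun S : SubPrederivator D => S.mem J Y) h.symm)
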